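/- Let $\beta>1$, let $T_\beta(x)=\beta x-\lfloor\beta x\rfloor$ on $[0,1)$, and for $x\in[0,1)$ let $\varepsilon_n(x)=\lfloor\beta T_\beta^{n-1}(x)\rfloor$, $n\ge1$, be the digits of its $\beta$-expansion. For $y\in[0,1)$ let $I_n(y)=\{z\in[0,1):\varepsilon_i(z)=\varepsilon_i(y),\ 1\le i\le n\}$, and for $x,y\in[0,1)$ let \[W_n^\beta(x,y)=\inf\{k\ge1:\ T_\beta^kx\in I_n(y)\}\in\{1,2,\dots\}\cup\{\infty\},\] with $\inf\emptyset=\infty$ and $\log\infty=\infty$. An accumulation point of the sequence $\big(\tfrac1n\log W_n^\beta(x,y)\big)_{n\ge1}$ is a point of $[-\infty,\infty]$ every neighbourhood of which contains infinitely many terms of the sequence (counted by index). Theorem. Let $J\subset(0,\infty)$ be a non-empty interval that is closed in $\mathbb R$, that is, $J=[a,b]$ with $0<a\le b<\infty$ or $J=[a,\infty)$ with $a>0$. Then the set \[\Big\{(x,y)\in[0,1)^2:\ \text{the set of real accumulation points of } \tfrac1n\log W_n^\beta(x,y)\text{ equals }J\Big\}\] has Hausdorff dimension $2$. If $J$ is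 bounded, then also the set of those $(x,y)\in[0,1)^2$ for which the set of all accumulation points in $[-\infty,\infty]$ equals $J$ (so that $\infty$ is not an accumulation point) has Hausdorff dimension $2$. -/

import Mathlib

open Set Filter

namespace BetaExpansion

noncomputable section

/-- The `β`-transformation `x ↦ βx - [βx]` (considered on `[0,1)`). -/
def T (β : ℝ) (x : ℝ) : ℝ := β * x - ⌊β * x⌋

/-- The `n`-th digit `[β T^{n-1} x]` of the `β`-expansion of `x`, for `n ≥ 1`. -/
def digit (β : ℝ) (x : ℝ) (n : ℕ) : ℤ := ⌊β * (T β)^[n - 1] x⌋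

/-- The basic interval `I_n(y)` of order `n` containing `y`: the points of `[0,1)` that have
the same first `n` digits as `y`. -/
def basicInterval (β : ℝ) (n : ℕ) (y : ℝ) : Set ℝ :=
  {z | z ∈ Ico (0 : ℝ) 1 ∧ ∀ i, 1 ≤ i → i ≤ n → digit β z i = digit β y i}

/-- The waiting time `inf {k ≥ 1 : T^k x ∈ I_n(y)}`, equal to `⊤` if there is no such `k`. -/
def waitingTime (β : ℝ) (n : ℕ) (x y : ℝ) : ℕ∞ :=
  ⨅ (k : ℕ) (_ : 1 ≤ k ∧ (T β)^[k] x ∈ basicInterval β n y), (k : ℕ∞)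

/-- The number `(1/n) log W_n(x,y)`, equal to `⊤` if the waiting time is infinite. -/
def waitingRate (β : ℝ) (x y : ℝ) (n : ℕ) : EReal :=
  ENNReal.log (waitingTime β n x y : ENNReal) / (n : EReal)

/-- The accumulation points, in the extended real line, of the sequence `(1/n) log W_n(x,y)`. -/
def accPoints (β : ℝ) (x y : ℝ) : Set EReal :=
  {t | MapClusterPt t atTop (waitingRate β x y)}

/-- The pairs in `[0,1)²` for which the set of real accumulation points of `(1/n) log W_n(x,y)`
is `J`. -/
def accLevelSet (β : ℝ) (J : Set ℝ) : Set (ℝ × ℝ) :=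
  {p | p.1 ∈ Ico (0 : ℝ) 1 ∧ p.2 ∈ Ico (0 : ℝ) 1 ∧
    {t : ℝ | (t : EReal) ∈ accPoints β p.1 p.2} = J}

/-- The pairs in `[0,1)²` for which the set of all accumulation points of `(1/n) log W_n(x,y)`
in the extended real line is `J` (so that `∞` is not one of them). -/
def extAccLevelSet (β : ℝ) (J : Set ℝ) : Set (ℝ × ℝ) :=
  {p | p.1 ∈ Ico (0 : ℝ) 1 ∧ p.2 ∈ Ico (0 : ℝ) 1 ∧
    accPoints β p.1 p.2 = (fun t : ℝ => (t : EReal)) '' J}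

end

end BetaExpansion

/-!
Fix a block length `m` and call letters the full basic intervals of order `m`, those which
`T β ^ m` maps onto `[0, 1)`; letters can be concatenated freely. Write `y` as a marker of three
zero letters followed by nonzero letters, and write `x` with nonzero letters, inserting at the
place `P l` the first `l` letters of `y` closed by a zero letter. The marker occurs in `x` only at
these places, and the closing zero ends each coincidence, so the waiting time for `m * l` digits is
exactly `m * P l`. With `P l` about `exp (m * l * h l)`, where `h` varies slowly and accumulates
exactly at `J`, monotonicity in `n` extends `log W n / n ≈ h (n / m)` to all `n`.

The insertions have density zero, so reading off the free letters of `x` and `y` as base `q` digits,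
`q` being the number of nonzero letters, is a Hölder map onto the unit square, with exponent
arbitrarily close to `log q / (m * log β)`. Intervals of length `β ^ (-m)`, at most `m + 1` for each
full interval of order `m`, cover `[0, 1)`; hence `q ≥ β ^ (m * r)` for any `r < 1` and large `m`,
and the exponent tends to `1`.
-/

namespace BetaExpansion

open scoped Topology

noncomputable section

lemma exists_monotone_lipschitz_retraction {J : Set ℝ} (hne : J.Nonempty) (hint : J.OrdConnected)
    (hclosed : IsClosed J) (hbdd : BddBelow J) :
    ∃ f : ℝ → ℝ, (∀ x, f x ∈ J) ∧ (∀ x ∈ J, f x = x) ∧ Monotone f ∧ LipschitzWith 1 f := by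
  have hinf : sInf J ∈ J := hclosed.csInf_mem hne hbdd
  by_cases hb : BddAbove J
  · have hsup : sSup J ∈ J := hclosed.csSup_mem hne hb
    refine ⟨fun x => max (sInf J) (min (sSup J) x), fun x => ?_, fun x hx => ?_,
      monotone_const.max (monotone_const.min monotone_id),
      (LipschitzWith.id.const_min _).const_max _⟩
    · exact hint.out hinf hsup
        ⟨le_max_left _ _, max_le (csInf_le hbdd hsup) (min_le_left _ _)⟩
    · simp only [min_eq_right (le_csSup hb hx), max_eq_right (csInf_le hbdd hx)]
  · refine ⟨fun x => max (sInf J) x, fun x => ?_, fun x hx => max_eq_right (csInf_le hbdd hx),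
      monotone_const.max monotone_id, LipschitzWith.id.const_max _⟩
    obtain ⟨y, hy, hxy⟩ := not_bddAbove_iff.1 hb (max (sInf J) x)
    exact hint.out hinf hy ⟨le_max_left _ _, hxy.le⟩

lemma mapClusterPt_of_tendsto_sub {ι : Type*} {F : Filter ι} {u v : ι → ℝ} {t : ℝ}
    (huv : Tendsto (fun i => u i - v i) F (𝓝 0)) (hv : MapClusterPt t F v) :
    MapClusterPt t F u := by
  obtain ⟨U, hU, hvU⟩ := mapClusterPt_iff_ultrafilter.1 hv
  refine mapClusterPt_iff_ultrafilter.2 ⟨U, hU, ?_⟩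
  simpa using (huv.mono_left hU).add hvU

lemma mapClusterPt_iff_of_tendsto_sub {ι : Type*} {F : Filter ι} {u v : ι → ℝ} {t : ℝ}
    (huv : Tendsto (fun i => u i - v i) F (𝓝 0)) :
    MapClusterPt t F u ↔ MapClusterPt t F v :=
  ⟨mapClusterPt_of_tendsto_sub (by simpa using huv.neg), mapClusterPt_of_tendsto_sub huv⟩

lemma mapClusterPt_comp_div_iff {X : Type*} [TopologicalSpace X] {h : ℕ → X} {m : ℕ} (hm : m ≠ 0)
    {x : X} : MapClusterPt x atTop (fun n => h (n / m)) ↔ MapClusterPt x atTop h := by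
  have hcomp := mapClusterPt_comp (F := atTop) (x := x) (φ := fun n : ℕ => n / m) (u := h)
  rwa [map_div_atTop_eq_nat m (Nat.pos_of_ne_zero hm)] at hcomp

lemma mapClusterPt_of_tendsto_succ_sub {s : ℕ → ℝ} {t : ℝ}
    (hs : Tendsto (fun n => s (n + 1) - s n) atTop (𝓝 0))
    (hle : ∃ᶠ n in atTop, s n ≤ t) (hge : ∃ᶠ n in atTop, t ≤ s n) : MapClusterPt t atTop s := by
  classical
  refine Metric.nhds_basis_ball.mapClusterPt_iff_frequently.2 fun ε hε => frequently_atTop.2 ?_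
  intro N
  obtain ⟨M, hM⟩ := eventually_atTop.1 (hs.eventually (Metric.ball_mem_nhds 0 hε))
  obtain ⟨i, hi, hsi⟩ := frequently_atTop.1 hle (max N M)
  have hex : ∃ k, t ≤ s (i + k) := by
    obtain ⟨j, hj, hsj⟩ := frequently_atTop.1 hge i
    exact ⟨j - i, by rwa [Nat.add_sub_cancel' hj]⟩
  obtain ⟨k, hk, hmin⟩ : ∃ k, t ≤ s (i + k) ∧ ∀ j < k, s (i + j) < t :=
    ⟨Nat.find hex, Nat.find_spec hex, fun j hj => not_le.1 (Nat.find_min hex hj)⟩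
  refine ⟨i + k, by omega, ?_⟩
  rw [Metric.mem_ball, Real.dist_eq, abs_of_nonneg (sub_nonneg.2 hk)]
  cases k with
  | zero => exact (sub_nonpos.2 hsi).trans_lt hε
  | succ k =>
    have hstep := hM (i + k) (by omega)
    rw [dist_zero_right, Real.norm_eq_abs] at hstep
    rw [← add_assoc]
    linarith [(abs_lt.1 hstep).2, hmin k k.lt_succ_self]

lemma tendsto_div_of_tendsto_succ_sub {s : ℕ → ℝ}
    (hs : Tendsto (fun n => s (n + 1) - s n) atTop (𝓝 0)) :
    Tendsto (fun n : ℕ => s n / n) atTop (𝓝 0) := by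
  have hzero : Tendsto (fun n : ℕ => s 0 / (n : ℝ)) atTop (𝓝 0) :=
    tendsto_const_nhds.div_atTop tendsto_natCast_atTop_atTop
  have h := hs.cesaro.add hzero
  rw [add_zero] at h
  refine h.congr fun n => ?_
  rw [Finset.sum_range_sub]
  ring

/-- A function with bounded slope on `(0, ∞)` that reaches `t` and `-t` for arbitrarily large
`t`. -/
def wave (t : ℝ) : ℝ := t * Real.sin (Real.log t)

lemma hasDerivAt_wave {t : ℝ} (ht : t ≠ 0) :
    HasDerivAt wave (Real.sin (Real.log t) + Real.cos (Real.log t)) t := by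
  have h := (hasDerivAt_id t).mul (Real.hasDerivAt_log ht).sin
  refine h.congr_deriv ?_
  simp only [id_eq]
  field_simp

lemma abs_wave_sub_le {s t : ℝ} (hs : 0 < s) (ht : 0 < t) : |wave t - wave s| ≤ 2 * |t - s| := by
  refine (convex_Ioi (0 : ℝ)).norm_image_sub_le_of_norm_hasDerivWithin_le
    (fun x hx => (hasDerivAt_wave (ne_of_gt hx)).hasDerivWithinAt) (fun x _ => ?_) hs ht
  refine (norm_add_le _ _).trans ?_
  rw [Real.norm_eq_abs, Real.norm_eq_abs]
  linarith [Real.abs_sin_le_one (Real.log x), Real.abs_cos_le_one (Real.log x)]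

lemma wave_exp (s : ℝ) : wave (Real.exp s) = Real.exp s * Real.sin s := by
  rw [wave, Real.log_exp]

lemma exists_le_wave_eq_self (M : ℝ) : ∃ t, M ≤ t ∧ wave t = t := by
  obtain ⟨k, hk⟩ := exists_nat_ge M
  refine ⟨Real.exp (Real.pi / 2 + k * (2 * Real.pi)), ?_, ?_⟩
  · refine hk.trans (le_trans ?_ (Real.add_one_le_exp _))
    nlinarith [Real.pi_gt_three, k.cast_nonneg (α := ℝ)]
  · rw [wave_exp, Real.sin_add_nat_mul_two_pi, Real.sin_pi_div_two, mul_one]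

lemma exists_le_wave_eq_neg (M : ℝ) : ∃ t, M ≤ t ∧ wave t = -t := by
  obtain ⟨k, hk⟩ := exists_nat_ge M
  refine ⟨Real.exp (-(Real.pi / 2) + (k + 1 : ℕ) * (2 * Real.pi)), ?_, ?_⟩
  · refine hk.trans (le_trans ?_ (Real.add_one_le_exp _))
    push_cast
    nlinarith [Real.pi_gt_three, k.cast_nonneg (α := ℝ)]
  · rw [wave_exp, Real.sin_add_nat_mul_two_pi, Real.sin_neg, Real.sin_pi_div_two, mul_neg_one]

lemma log_add_one_sub_log_le {x : ℝ} (hx : 0 < x) : Real.log (x + 1) - Real.log x ≤ 1 / x := by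
  rw [← Real.log_div (by positivity) hx.ne']
  refine (Real.log_le_sub_one_of_pos (by positivity)).trans_eq ?_
  field_simp
  ring

lemma exists_abs_log_sub_le_one (N : ℕ) {t : ℝ} (ht : Real.log (N + 2) ≤ t) :
    ∃ n ≥ N, |Real.log (n + 2) - t| ≤ 1 := by
  have hexp : (N : ℝ) + 2 ≤ Real.exp t := (Real.log_le_iff_le_exp (by positivity)).1 ht
  have hfloor : N + 2 ≤ ⌊Real.exp t⌋₊ := Nat.le_floor (by exact_mod_cast hexp)
  obtain ⟨n, hn⟩ := Nat.exists_eq_add_of_le' (show 2 ≤ ⌊Real.exp t⌋₊ by omega)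
  refine ⟨n, by omega, ?_⟩
  have hle : (n : ℝ) + 2 ≤ Real.exp t := by
    exact_mod_cast hn ▸ Nat.floor_le (Real.exp_pos t).le
  have hlt : Real.exp t ≤ n + 2 + 1 := by
    exact_mod_cast hn ▸ (Nat.lt_floor_add_one (Real.exp t)).le
  have hlog_le : Real.log (n + 2) ≤ t := (Real.log_le_iff_le_exp (by positivity)).2 hle
  have hle_log : t ≤ Real.log (n + 2 + 1) := (Real.le_log_iff_exp_le (by positivity)).2 hlt
  have hgap := log_add_one_sub_log_le (show (0 : ℝ) < n + 2 by positivity)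
  have hone : 1 / ((n : ℝ) + 2) ≤ 1 := by
    rw [div_le_one (by positivity)]
    linarith [n.cast_nonneg (α := ℝ)]
  rw [abs_le]
  constructor <;> linarith

/-- The function `wave` sampled along the logarithms of the integers from `2` on, so that its
steps are `O(1 / n)`. -/
def logWave (n : ℕ) : ℝ := wave (Real.log (n + 2))

lemma log_natCast_add_two_pos (n : ℕ) : 0 < Real.log ((n : ℝ) + 2) :=
  Real.log_pos (by linarith [n.cast_nonneg (α := ℝ)])

lemma abs_logWave_succ_sub_le (n : ℕ) : |logWave (n + 1) - logWave n| ≤ 2 / (n + 1) := by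
  have hmono : Real.log ((n : ℝ) + 2) ≤ Real.log ((n + 1 : ℕ) + 2) :=
    Real.log_le_log (by positivity) (by push_cast; linarith)
  refine (abs_wave_sub_le (log_natCast_add_two_pos n) (log_natCast_add_two_pos (n + 1))).trans ?_
  rw [abs_of_nonneg (sub_nonneg.2 hmono)]
  have hlog := log_add_one_sub_log_le (show (0 : ℝ) < n + 2 by positivity)
  have hinv : 1 / ((n : ℝ) + 2) ≤ 1 / (n + 1) := by gcongr; norm_num
  have hcast : ((n + 1 : ℕ) : ℝ) + 2 = n + 2 + 1 := by push_cast; ring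
  rw [hcast, show (2 : ℝ) / (n + 1) = 2 * (1 / (n + 1)) by ring]
  linarith

lemma exists_abs_logWave_sub_wave_le (N : ℕ) {t : ℝ} (ht : Real.log (N + 2) ≤ t) :
    ∃ n ≥ N, |logWave n - wave t| ≤ 2 := by
  obtain ⟨n, hn, hlog⟩ := exists_abs_log_sub_le_one N ht
  refine ⟨n, hn, (abs_wave_sub_le ((log_natCast_add_two_pos N).trans_le ht)
    (log_natCast_add_two_pos n)).trans ?_⟩
  linarith

lemma frequently_le_logWave (M : ℝ) : ∃ᶠ n in atTop, M ≤ logWave n := by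
  refine frequently_atTop.2 fun N => ?_
  obtain ⟨t, ht, hwave⟩ := exists_le_wave_eq_self (max (Real.log (N + 2)) (M + 2))
  obtain ⟨n, hn, hclose⟩ := exists_abs_logWave_sub_wave_le N ((le_max_left _ _).trans ht)
  refine ⟨n, hn, ?_⟩
  linarith [(abs_le.1 hclose).1, (le_max_right _ _).trans ht]

lemma frequently_logWave_le (M : ℝ) : ∃ᶠ n in atTop, logWave n ≤ M := by
  refine frequently_atTop.2 fun N => ?_
  obtain ⟨t, ht, hwave⟩ := exists_le_wave_eq_neg (max (Real.log (N + 2)) (2 - M))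
  obtain ⟨n, hn, hclose⟩ := exists_abs_logWave_sub_wave_le N ((le_max_left _ _).trans ht)
  refine ⟨n, hn, ?_⟩
  linarith [(abs_le.1 hclose).2, (le_max_right _ _).trans ht]

lemma tendsto_succ_sub_of_abs_le {s : ℕ → ℝ} {c : ℝ}
    (hs : ∀ n : ℕ, |s (n + 1) - s n| ≤ c / (n + 1)) :
    Tendsto (fun n => s (n + 1) - s n) atTop (𝓝 0) := by
  refine squeeze_zero_norm (fun n => hs n) ?_
  have hlim := (tendsto_one_div_add_atTop_nhds_zero_nat (𝕜 := ℝ)).const_mul c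
  rw [mul_zero] at hlim
  exact hlim.congr fun n => mul_one_div _ _

lemma exists_slow_seq_mapClusterPt_iff {J : Set ℝ} (hne : J.Nonempty) (hint : J.OrdConnected)
    (hclosed : IsClosed J) (hbdd : BddBelow J) {c : ℝ} (hc : 0 < c) :
    ∃ h : ℕ → ℝ, (∀ n, h n ∈ J) ∧ (∀ n : ℕ, |h (n + 1) - h n| ≤ c / (n + 1)) ∧
      ∀ t, MapClusterPt t atTop h ↔ t ∈ J := by
  obtain ⟨f, hfJ, hfid, hmono, hlip⟩ :=
    exists_monotone_lipschitz_retraction hne hint hclosed hbdd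
  have hc2 : 0 < c / 2 := half_pos hc
  set h : ℕ → ℝ := fun n => f (c / 2 * logWave n)
  have hstep (n : ℕ) : |h (n + 1) - h n| ≤ c / (n + 1) := by
    calc |h (n + 1) - h n| ≤ |c / 2 * logWave (n + 1) - c / 2 * logWave n| := by
          simpa only [Real.dist_eq, NNReal.coe_one, one_mul] using hlip.dist_le_mul _ _
      _ = c / 2 * |logWave (n + 1) - logWave n| := by
          rw [← mul_sub, abs_mul, abs_of_pos hc2]
      _ ≤ c / 2 * (2 / (n + 1)) := by gcongr; exact abs_logWave_succ_sub_le n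
      _ = c / (n + 1) := by ring
  refine ⟨h, fun n => hfJ _, hstep, fun t => ⟨fun ht => ?_, fun ht => ?_⟩⟩
  · exact hclosed.mem_of_mapClusterPt ht (.of_forall fun n => hfJ _)
  · refine mapClusterPt_of_tendsto_succ_sub (tendsto_succ_sub_of_abs_le hstep)
      ((frequently_logWave_le (t / (c / 2))).mono fun n hn => ?_)
      ((frequently_le_logWave (t / (c / 2))).mono fun n hn => ?_)
    · exact (hmono ((le_div_iff₀' hc2).1 hn)).trans_eq (hfid t ht)
    · exact (hfid t ht).symm.trans_le (hmono ((div_le_iff₀' hc2).1 hn))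

lemma div_mul_div_sub_le_div {f : ℕ → ℝ} (hmono : Monotone f) (hf : ∀ n, 0 ≤ f n) {m n q : ℕ}
    (hm : 0 < m) (hq : 0 < q) (hle : m * q ≤ n) (hlt : n ≤ m * (q + 1)) :
    f (m * q) / (m * q : ℕ) - f (m * q) / (m * q : ℕ) / q ≤ f n / n := by
  have hn : (0 : ℝ) < n := by exact_mod_cast (Nat.mul_pos hm hq).trans_le hle
  calc f (m * q) / (m * q : ℕ) - f (m * q) / (m * q : ℕ) / q
      = f (m * q) / (m * (q + 1) : ℕ) - f (m * q) / (m * q ^ 2 * (q + 1) : ℕ) := by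
        push_cast; field_simp; ring
    _ ≤ f (m * q) / (m * (q + 1) : ℕ) := sub_le_self _ (div_nonneg (hf _) (Nat.cast_nonneg _))
    _ ≤ f n / n := by gcongr; exacts [hf _, hmono hle]

lemma div_le_div_mul_add_div {f : ℕ → ℝ} (hmono : Monotone f) (hf : ∀ n, 0 ≤ f n) {m n q : ℕ}
    (hm : 0 < m) (hq : 0 < q) (hle : m * q ≤ n) (hlt : n ≤ m * (q + 1)) :
    f n / n ≤ f (m * (q + 1)) / (m * (q + 1) : ℕ) + f (m * (q + 1)) / (m * (q + 1) : ℕ) / q := by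
  calc f n / n ≤ f (m * (q + 1)) / (m * q : ℕ) := by gcongr; exacts [hf _, hmono hlt]
    _ = _ := by push_cast; field_simp

/-- For `q = n / m` monotonicity puts `f n` between `f (m q)` and `f (m (q + 1))`, and a sequence
with vanishing steps is `o(q)`, so replacing `n` by `m q` or `m (q + 1)` in the denominator is
harmless. -/
lemma tendsto_div_sub_comp_div {f : ℕ → ℝ} (hmono : Monotone f) (hf : ∀ n, 0 ≤ f n) {m : ℕ}
    (hm : m ≠ 0)
    (hstep : Tendsto (fun q : ℕ => f (m * (q + 1)) / (m * (q + 1) : ℕ) - f (m * q) / (m * q : ℕ))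
      atTop (𝓝 0)) :
    Tendsto (fun n => f n / n - f (m * (n / m)) / (m * (n / m) : ℕ)) atTop (𝓝 0) := by
  set s : ℕ → ℝ := fun q => f (m * q) / (m * q : ℕ) with hs
  have hdiv := Nat.tendsto_div_const_atTop hm
  have hstep' : Tendsto (fun q => s (q + 1) - s q) atTop (𝓝 0) := hstep
  have hslow : Tendsto (fun q : ℕ => s q / q) atTop (𝓝 0) := tendsto_div_of_tendsto_succ_sub hstep'
  have hlower : Tendsto (fun q : ℕ => -(s q / q)) atTop (𝓝 0) := by
    simpa only [neg_zero] using hslow.neg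
  have hupper : Tendsto (fun q : ℕ => (s (q + 1) - s q) + ((s (q + 1) - s q) / q + s q / q))
      atTop (𝓝 0) := by
    simpa only [add_zero] using
      hstep'.add ((hstep'.div_atTop tendsto_natCast_atTop_atTop).add hslow)
  have hm0 : 0 < m := Nat.pos_of_ne_zero hm
  refine tendsto_of_tendsto_of_tendsto_of_le_of_le' (hlower.comp hdiv) (hupper.comp hdiv) ?_ ?_
  · filter_upwards [eventually_ge_atTop m] with n hn
    have hbound := div_mul_div_sub_le_div hmono hf hm0 (Nat.div_pos hn hm0) (Nat.mul_div_le n m)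
      (Nat.lt_mul_div_succ n hm0).le
    simp only [Function.comp_apply, hs]
    linarith
  · filter_upwards [eventually_ge_atTop m] with n hn
    have hbound := div_le_div_mul_add_div hmono hf hm0 (Nat.div_pos hn hm0) (Nat.mul_div_le n m)
      (Nat.lt_mul_div_succ n hm0).le
    simp only [Function.comp_apply, hs]
    refine (sub_le_sub_right hbound _).trans_eq ?_
    ring

lemma tendsto_div_sub_comp_div_of_tendsto {f h : ℕ → ℝ} (hmono : Monotone f) (hf : ∀ n, 0 ≤ f n)
    {m : ℕ} (hm : m ≠ 0) (hh : Tendsto (fun n => h (n + 1) - h n) atTop (𝓝 0))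
    (hfh : Tendsto (fun q => f (m * q) / (m * q : ℕ) - h q) atTop (𝓝 0)) :
    Tendsto (fun n => f n / n - h (n / m)) atTop (𝓝 0) := by
  have hstep := (((tendsto_add_atTop_iff_nat 1).2 hfh).sub hfh).add hh
  rw [sub_zero, add_zero] at hstep
  have hsum := (tendsto_div_sub_comp_div hmono hf hm (hstep.congr fun q => by ring)).add
    (hfh.comp (Nat.tendsto_div_const_atTop hm))
  rw [add_zero] at hsum
  exact hsum.congr fun n => sub_add_sub_cancel _ _ _

/-- The digits of the `β`-expansion of `x`, indexed from `0`. -/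
def digitSeq (β x : ℝ) (i : ℕ) : ℤ := ⌊β * (T β)^[i] x⌋

/-- The points `c + t / β ^ n` with `0 ≤ t < ℓ` share their first `n` digits, and `T β ^ n` maps
them affinely onto `[0, ℓ)`. This is vacuous for `ℓ ≤ 0`. -/
def IsBranch (β : ℝ) (n : ℕ) (c ℓ : ℝ) : Prop :=
  ∀ t ∈ Ico 0 ℓ, c + t / β ^ n ∈ Ico (0 : ℝ) 1 ∧ (T β)^[n] (c + t / β ^ n) = t ∧
    ∀ i < n, digitSeq β (c + t / β ^ n) i = digitSeq β c i

/-- `c` is the left endpoint of a full basic interval of order `n`. -/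
def IsFull (β : ℝ) (n : ℕ) (c : ℝ) : Prop := IsBranch β n c 1

section FullIntervals

variable {β : ℝ}

lemma T_eq_fract (x : ℝ) : T β x = Int.fract (β * x) := rfl

lemma T_mem_Ico (x : ℝ) : T β x ∈ Ico (0 : ℝ) 1 := ⟨Int.fract_nonneg _, Int.fract_lt_one _⟩

lemma iterate_T_mem_Ico {x : ℝ} (hx : x ∈ Ico (0 : ℝ) 1) (n : ℕ) :
    (T β)^[n] x ∈ Ico (0 : ℝ) 1 := by
  cases n with
  | zero => exact hx
  | succ n => exact Function.iterate_succ_apply' (T β) n x ▸ T_mem_Ico _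

lemma iterate_T_one_mem_Icc (n : ℕ) : (T β)^[n] 1 ∈ Icc (0 : ℝ) 1 := by
  cases n with
  | zero => exact right_mem_Icc.2 zero_le_one
  | succ n =>
    exact Function.iterate_succ_apply' (T β) n 1 ▸ Ico_subset_Icc_self (T_mem_Ico _)

lemma iterate_T_zero (n : ℕ) : (T β)^[n] 0 = 0 :=
  Function.iterate_fixed (by simp [T]) n

lemma digitSeq_zero (i : ℕ) : digitSeq β 0 i = 0 := by
  rw [digitSeq, iterate_T_zero, mul_zero, Int.floor_zero]

lemma digitSeq_iterate (x : ℝ) (k i : ℕ) :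
    digitSeq β ((T β)^[k] x) i = digitSeq β x (k + i) := by
  rw [digitSeq, digitSeq, add_comm k i, Function.iterate_add_apply]

lemma iterate_T_succ_eq (x : ℝ) (n : ℕ) :
    (T β)^[n + 1] x = β * (T β)^[n] x - digitSeq β x n := by
  rw [Function.iterate_succ_apply']; rfl

lemma iterate_T_of_digitSeq_eq_zero {x : ℝ} {n : ℕ} (h : ∀ i < n, digitSeq β x i = 0) :
    (T β)^[n] x = β ^ n * x := by
  induction n with
  | zero => simp
  | succ n ih =>
    rw [iterate_T_succ_eq, h n n.lt_succ_self, ih fun i hi => h i (by omega)]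
    push_cast
    ring

lemma IsFull.add_div_mem_Ico {n : ℕ} {c t : ℝ} (hc : IsFull β n c) (ht : t ∈ Ico (0 : ℝ) 1) :
    c + t / β ^ n ∈ Ico (0 : ℝ) 1 := (hc t ht).1

lemma IsFull.iterate_T_add_div {n : ℕ} {c t : ℝ} (hc : IsFull β n c) (ht : t ∈ Ico (0 : ℝ) 1) :
    (T β)^[n] (c + t / β ^ n) = t := (hc t ht).2.1

lemma IsFull.digitSeq_add_div {n i : ℕ} {c t : ℝ} (hc : IsFull β n c) (ht : t ∈ Ico (0 : ℝ) 1)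
    (hi : i < n) : digitSeq β (c + t / β ^ n) i = digitSeq β c i := (hc t ht).2.2 i hi

lemma IsFull.mem_Ico {n : ℕ} {c : ℝ} (hc : IsFull β n c) : c ∈ Ico (0 : ℝ) 1 := by
  simpa only [zero_div, add_zero] using hc.add_div_mem_Ico (left_mem_Ico.2 one_pos)

lemma IsFull.iterate_T_eq_zero {n : ℕ} {c : ℝ} (hc : IsFull β n c) : (T β)^[n] c = 0 := by
  simpa only [zero_div, add_zero] using hc.iterate_T_add_div (left_mem_Ico.2 one_pos)

lemma IsFull.add_inv_le_one (hβ : 0 < β) {n : ℕ} {c : ℝ} (hc : IsFull β n c) :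
    c + 1 / β ^ n ≤ 1 := by
  have hb : 0 < β ^ n := by positivity
  by_contra! hlt
  have ht : (1 - c) * β ^ n ∈ Ico (0 : ℝ) 1 :=
    ⟨mul_nonneg (sub_nonneg.2 hc.mem_Ico.2.le) hb.le,
      (lt_div_iff₀ hb).1 (sub_lt_iff_lt_add'.2 hlt)⟩
  have hmem := (hc.add_div_mem_Ico ht).2
  rw [mul_div_cancel_right₀ _ hb.ne', add_sub_cancel] at hmem
  exact hmem.false

lemma IsFull.add_inv_le (hβ : 0 < β) {n : ℕ} {c d : ℝ} (hc : IsFull β n c) (hd : IsFull β n d)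
    (hcd : c < d) : c + 1 / β ^ n ≤ d := by
  have hb : 0 < β ^ n := by positivity
  by_contra! hlt
  have ht : (d - c) * β ^ n ∈ Ico (0 : ℝ) 1 :=
    ⟨mul_nonneg (sub_nonneg.2 hcd.le) hb.le, (lt_div_iff₀ hb).1 (sub_lt_iff_lt_add'.2 hlt)⟩
  have hT := hc.iterate_T_add_div ht
  rw [mul_div_cancel_right₀ _ hb.ne', add_sub_cancel, hd.iterate_T_eq_zero] at hT
  exact (mul_pos (sub_pos.2 hcd) hb).ne hT

lemma IsFull.inv_le_abs_sub (hβ : 0 < β) {n : ℕ} {c d : ℝ} (hc : IsFull β n c)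
    (hd : IsFull β n d) (hcd : c ≠ d) : 1 / β ^ n ≤ |c - d| := by
  rcases hcd.lt_or_gt with hlt | hlt
  · rw [abs_of_neg (sub_neg.2 hlt)]
    linarith [hc.add_inv_le hβ hd hlt]
  · rw [abs_of_pos (sub_pos.2 hlt)]
    linarith [hd.add_inv_le hβ hc hlt]

lemma IsBranch.comp (hβ : 0 < β) {n k : ℕ} {c d a b : ℝ} (hc : IsBranch β n c a)
    (hd : IsBranch β k d b) (hab : ∀ t ∈ Ico 0 b, d + t / β ^ k < a) :
    IsBranch β (n + k) (c + d / β ^ n) b := by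
  intro t ht
  have hzero : (0 : ℝ) ∈ Ico 0 b := left_mem_Ico.2 (ht.1.trans_lt ht.2)
  have hd0 : d ∈ Ico 0 a := by
    have hmem : d + 0 / β ^ k ∈ Ico 0 a := ⟨(hd 0 hzero).1.1, hab 0 hzero⟩
    rwa [zero_div, add_zero] at hmem
  have heq : c + d / β ^ n + t / β ^ (n + k) = c + (d + t / β ^ k) / β ^ n := by
    rw [pow_add]; field_simp; ring
  obtain ⟨hmem_d, hT_d, hdigit_d⟩ := hd t ht
  obtain ⟨hmem, hT, hdigit⟩ := hc _ ⟨hmem_d.1, hab t ht⟩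
  obtain ⟨-, hT₀, hdigit₀⟩ := hc d hd0
  rw [heq]
  refine ⟨hmem, by rw [add_comm n k, Function.iterate_add_apply, hT, hT_d], fun i hi => ?_⟩
  rcases lt_or_ge i n with h | h
  · rw [hdigit i h, hdigit₀ i h]
  · obtain ⟨j, rfl⟩ := Nat.exists_eq_add_of_le h
    rw [← digitSeq_iterate, ← digitSeq_iterate, hT, hT₀, hdigit_d j (by omega)]

lemma isBranch_one (hβ : 0 < β) {i : ℤ} {ℓ : ℝ} (hi : 0 ≤ i) (hℓ : ℓ ≤ 1) (hiℓ : i + ℓ ≤ β) :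
    IsBranch β 1 (i / β) ℓ := by
  intro t ht
  have hi' : (0 : ℝ) ≤ i := by exact_mod_cast hi
  have ht01 : t ∈ Ico (0 : ℝ) 1 := ⟨ht.1, ht.2.trans_le hℓ⟩
  have hmul : β * (i / β + t / β ^ 1) = i + t := by field_simp
  refine ⟨⟨?_, ?_⟩, ?_, fun j hj => ?_⟩
  · exact add_nonneg (div_nonneg hi' hβ.le) (div_nonneg ht.1 (by positivity))
  · rw [pow_one, ← add_div, div_lt_one hβ]
    linarith [ht.2]
  · rw [Function.iterate_one, T_eq_fract, hmul, Int.fract_intCast_add, Int.fract_eq_self.2 ht01]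
  · obtain rfl : j = 0 := by omega
    rw [digitSeq, digitSeq, Function.iterate_zero_apply, Function.iterate_zero_apply, hmul,
      mul_div_cancel₀ _ hβ.ne', Int.floor_intCast_add, Int.floor_intCast,
      Int.floor_eq_zero_iff.2 ht01, add_zero]

lemma IsFull.comp (hβ : 0 < β) {n k : ℕ} {c d : ℝ} (hc : IsFull β n c) (hd : IsFull β k d) :
    IsFull β (n + k) (c + d / β ^ n) :=
  IsBranch.comp hβ hc hd fun _ ht => (hd.add_div_mem_Ico ht).2

lemma isFull_zero (hβ : 1 < β) (n : ℕ) : IsFull β n 0 := by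
  induction n with
  | zero => exact fun t ht => by simpa using ht
  | succ n ih =>
    have hone : IsBranch β 1 0 1 := by
      simpa using isBranch_one (i := 0) (ℓ := 1) (by linarith) le_rfl le_rfl (by simpa using hβ.le)
    simpa using ih.comp (by linarith) hone

lemma IsFull.mono (hβ : 1 < β) {n k : ℕ} {c : ℝ} (hc : IsFull β n c) (hnk : n ≤ k) :
    IsFull β k c := by
  obtain ⟨j, rfl⟩ := Nat.exists_eq_add_of_le hnk
  simpa using hc.comp (by linarith) (isFull_zero hβ j)

/-- The left endpoint of the last basic interval of order `n`: the sum of the first `n` terms of the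
expansion of `1`. It is `1` itself if `(T β)^[n] 1 = 0`. -/
def lastPoint (β : ℝ) (n : ℕ) : ℝ := 1 - (T β)^[n] 1 / β ^ n

lemma lastPoint_zero : lastPoint β 0 = 0 := by simp [lastPoint]

lemma lastPoint_succ (hβ : 0 < β) (n : ℕ) :
    lastPoint β (n + 1) = lastPoint β n + digitSeq β 1 n / β / β ^ n := by
  rw [lastPoint, lastPoint, iterate_T_succ_eq, pow_succ]
  field_simp
  ring

lemma one_sub_inv_pow_le_lastPoint (hβ : 0 < β) (n : ℕ) : 1 - 1 / β ^ n ≤ lastPoint β n := by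
  rw [lastPoint]
  gcongr
  exact (iterate_T_one_mem_Icc n).2

lemma digitSeq_one_nonneg (hβ : 0 < β) (n : ℕ) : 0 ≤ digitSeq β 1 n :=
  Int.floor_nonneg.2 (mul_nonneg hβ.le (iterate_T_one_mem_Icc n).1)

lemma digitSeq_one_le (n : ℕ) : digitSeq β 1 n ≤ β * (T β)^[n] 1 := Int.floor_le _

lemma isBranch_lastPoint (hβ : 0 < β) (n : ℕ) : IsBranch β n (lastPoint β n) ((T β)^[n] 1) := by
  induction n with
  | zero => exact fun t ht => by simpa [lastPoint_zero] using ht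
  | succ n ih =>
    have hsum : digitSeq β 1 n + (T β)^[n + 1] 1 = β * (T β)^[n] 1 := by
      rw [iterate_T_succ_eq]; ring
    rw [lastPoint_succ hβ]
    refine ih.comp hβ (isBranch_one hβ (digitSeq_one_nonneg hβ n) (iterate_T_one_mem_Icc _).2
      (hsum.trans_le (mul_le_of_le_one_right hβ.le (iterate_T_one_mem_Icc n).2))) fun t ht => ?_
    rw [pow_one, ← add_div, div_lt_iff₀' hβ]
    linarith [ht.2]

lemma isFull_lastPoint_add (hβ : 0 < β) (n : ℕ) {i : ℤ} (hi : 0 ≤ i) (hlt : i < digitSeq β 1 n) :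
    IsFull β (n + 1) (lastPoint β n + i / β / β ^ n) := by
  have hle : (i : ℝ) + 1 ≤ β * (T β)^[n] 1 :=
    le_trans (by exact_mod_cast hlt) (digitSeq_one_le n)
  refine (isBranch_lastPoint hβ n).comp hβ (isBranch_one hβ hi le_rfl
    (hle.trans (mul_le_of_le_one_right hβ.le (iterate_T_one_mem_Icc n).2))) fun t ht => ?_
  rw [pow_one, ← add_div, div_lt_iff₀' hβ]
  linarith [ht.2]

lemma exists_isFull_of_mem_Ico_lastPoint (hβ : 0 < β) {n : ℕ} {z : ℝ}
    (hz : z ∈ Ico (lastPoint β n) (lastPoint β (n + 1))) :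
    ∃ c, IsFull β (n + 1) c ∧ (z - c) * β ^ (n + 1) ∈ Ico (0 : ℝ) 1 := by
  set w : ℝ := (z - lastPoint β n) * β ^ (n + 1) with hw
  have hw0 : 0 ≤ w := mul_nonneg (sub_nonneg.2 hz.1) (by positivity)
  have hlt : w < digitSeq β 1 n := by
    have hdiff := sub_lt_iff_lt_add'.2 (lastPoint_succ hβ n ▸ hz.2)
    rwa [div_div, ← pow_succ', lt_div_iff₀ (by positivity)] at hdiff
  refine ⟨_, isFull_lastPoint_add hβ n (Int.floor_nonneg.2 hw0) (Int.floor_lt.2 hlt), ?_⟩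
  have hfract : (z - (lastPoint β n + ⌊w⌋ / β / β ^ n)) * β ^ (n + 1) = Int.fract w := by
    rw [Int.fract, hw, pow_succ]; field_simp; ring
  exact hfract ▸ ⟨Int.fract_nonneg w, Int.fract_lt_one w⟩

lemma exists_isFull_mem_Ico_lastPoint (hβ : 0 < β) {z : ℝ} (hz : z ∈ Ico (0 : ℝ) 1) (n : ℕ) :
    ∃ k j c, k + j = n ∧ IsFull β k c ∧ (z - c) * β ^ k ∈ Ico (lastPoint β j) 1 := by
  induction n with
  | zero =>
    exact ⟨0, 0, 0, rfl, fun t ht => by simpa using ht, by simpa [lastPoint_zero] using hz⟩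
  | succ n ih =>
    obtain ⟨k, j, c, rfl, hc, hmem⟩ := ih
    rcases le_or_gt (lastPoint β (j + 1)) ((z - c) * β ^ k) with hle | hlt
    · exact ⟨k, j + 1, c, rfl, hc, hle, hmem.2⟩
    · obtain ⟨d, hd, hdmem⟩ := exists_isFull_of_mem_Ico_lastPoint hβ ⟨hmem.1, hlt⟩
      refine ⟨k + (j + 1), 0, _, rfl, hc.comp hβ hd, ?_⟩
      have heq : (z - (c + d / β ^ k)) * β ^ (k + (j + 1)) =
          ((z - c) * β ^ k - d) * β ^ (j + 1) := by
        rw [pow_add]; field_simp; ring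
      rwa [lastPoint_zero, heq]

lemma exists_isFull_covering (hβ : 0 < β) {z : ℝ} (hz : z ∈ Ico (0 : ℝ) 1) (n : ℕ) :
    ∃ k ≤ n, ∃ c, IsFull β k c ∧
      z ∈ Ico (c + 1 / β ^ k - 1 / β ^ n) (c + 1 / β ^ k - 1 / β ^ n + 1 / β ^ n) := by
  obtain ⟨k, j, c, rfl, hc, hle, hlt⟩ := exists_isFull_mem_Ico_lastPoint hβ hz n
  have hb : 0 < β ^ k := by positivity
  refine ⟨k, k.le_add_right j, c, hc, ?_, ?_⟩
  · have hscale : (1 - 1 / β ^ j) / β ^ k ≤ z - c :=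
      (div_le_iff₀ hb).2 ((one_sub_inv_pow_le_lastPoint hβ j).trans hle)
    rw [sub_div, div_div, ← pow_add, add_comm j k] at hscale
    linarith
  · linarith [(lt_div_iff₀ hb).2 hlt]

lemma finite_setOf_isFull (hβ : 0 < β) (n : ℕ) : {c | IsFull β n c}.Finite := by
  have hb : 0 < β ^ n := by positivity
  refine Set.Finite.of_injOn (f := fun c => ⌊c * β ^ n⌋) (t := Icc 0 ⌊β ^ n⌋) (fun c hc => ?_)
    (fun c hc d hd hcd => ?_) (finite_Icc _ _)
  · exact ⟨Int.floor_nonneg.2 (mul_nonneg hc.mem_Ico.1 hb.le),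
      Int.floor_le_floor (mul_le_of_le_one_left hb.le hc.mem_Ico.2.le)⟩
  · by_contra hne
    have hlt := Int.abs_sub_lt_one_of_floor_eq_floor hcd
    rw [← sub_mul, abs_mul, abs_of_pos hb, ← lt_div_iff₀ hb] at hlt
    exact (hc.inv_le_abs_sub hβ hd hne).not_gt hlt

lemma pow_le_mul_ncard_isFull (hβ : 1 < β) (n : ℕ) :
    β ^ n ≤ (n + 1) * {c | IsFull β n c}.ncard := by
  have hβ0 : 0 < β := by linarith
  have hfin := finite_setOf_isFull hβ0 n
  have hcover : Ico (0 : ℝ) 1 ⊆ ⋃ p ∈ Finset.range (n + 1) ×ˢ hfin.toFinset,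
      Ico (p.2 + 1 / β ^ p.1 - 1 / β ^ n) (p.2 + 1 / β ^ p.1 - 1 / β ^ n + 1 / β ^ n) := by
    intro z hz
    obtain ⟨k, hk, c, hc, hmem⟩ := exists_isFull_covering hβ0 hz n
    exact mem_iUnion₂.2 ⟨(k, c), Finset.mem_product.2 ⟨Finset.mem_range.2 (by omega),
      hfin.mem_toFinset.2 (hc.mono hβ hk)⟩, hmem⟩
  have hvol := (MeasureTheory.measure_mono (μ := MeasureTheory.volume) hcover).trans
    (MeasureTheory.measure_biUnion_finset_le _ _)
  simp only [Real.volume_Ico, add_sub_cancel_left, Finset.sum_const, sub_zero,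
    Finset.card_product, Finset.card_range, nsmul_eq_mul] at hvol
  rw [ENNReal.ofReal_one, ← ENNReal.ofReal_natCast, ← ENNReal.ofReal_mul (by positivity),
    ENNReal.one_le_ofReal, mul_one_div, one_le_div (by positivity)] at hvol
  rw [ncard_eq_toFinset_card _ hfin]
  exact_mod_cast hvol

/-- The block letters: left endpoints of the full intervals of order `m` other than those ending
within `1 / β ^ m` of `1`. The gap left at `1` keeps the points coded by sequences of letters
apart, see `inv_le_abs_code_sub`. -/
def IsLetter (β : ℝ) (m : ℕ) (c : ℝ) : Prop := IsFull β m c ∧ c ≤ 1 - 2 / β ^ m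

/-- The letters other than `0`, which is reserved for markers. -/
def nonzeroLetters (β : ℝ) (m : ℕ) : Set ℝ := {c | IsLetter β m c ∧ c ≠ 0}

lemma IsLetter.mem_Icc {m : ℕ} {c : ℝ} (hc : IsLetter β m c) : c ∈ Icc 0 (1 - 2 / β ^ m) :=
  ⟨hc.1.mem_Ico.1, hc.2⟩

lemma IsLetter.exists_digitSeq_ne_zero (hβ : 0 < β) {m : ℕ} {c : ℝ} (hc : IsLetter β m c)
    (hne : c ≠ 0) : ∃ s < m, digitSeq β c s ≠ 0 := by
  by_contra! hzero
  have hT := iterate_T_of_digitSeq_eq_zero hzero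
  rw [hc.1.iterate_T_eq_zero] at hT
  exact mul_ne_zero (pow_pos hβ m).ne' hne hT.symm

lemma finite_nonzeroLetters (hβ : 0 < β) (m : ℕ) : (nonzeroLetters β m).Finite :=
  (finite_setOf_isFull hβ m).subset fun _ hc => hc.1.1

lemma ncard_isFull_le_ncard_nonzeroLetters_add_two (hβ : 1 < β) (m : ℕ) :
    {c | IsFull β m c}.ncard ≤ (nonzeroLetters β m).ncard + 2 := by
  have hβ0 : 0 < β := by linarith
  obtain ⟨M, hM, hmax⟩ := exists_max_image {c | IsFull β m c} id (finite_setOf_isFull hβ0 m)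
    ⟨0, isFull_zero hβ m⟩
  have hsub : {c | IsFull β m c} ⊆ insert 0 (insert M (nonzeroLetters β m)) := by
    intro c hc
    by_cases hc0 : c = 0
    · exact .inl hc0
    by_cases hcM : c = M
    · exact .inr (.inl hcM)
    have hlt : c + 1 / β ^ m ≤ M := hc.add_inv_le hβ0 hM ((hmax c hc).lt_of_ne hcM)
    have htwo : 2 / β ^ m = 1 / β ^ m + 1 / β ^ m := by ring
    exact .inr (.inr ⟨⟨hc, by linarith [hM.add_inv_le_one hβ0]⟩, hc0⟩)
  calc {c | IsFull β m c}.ncard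
      ≤ (insert 0 (insert M (nonzeroLetters β m))).ncard :=
        ncard_le_ncard hsub (((finite_nonzeroLetters hβ0 m).insert M).insert 0)
    _ ≤ (nonzeroLetters β m).ncard + 1 + 1 :=
        (ncard_insert_le _ _).trans (Nat.add_le_add_right (ncard_insert_le _ _) 1)

lemma eventually_mul_succ_lt_pow {a q : ℝ} (hq : 1 < q) :
    ∀ᶠ m : ℕ in atTop, a * (m + 1) < q ^ m := by
  have hlim : Tendsto (fun m : ℕ => a * ((m : ℝ) ^ 1 / q ^ m + (m : ℝ) ^ 0 / q ^ m)) atTop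
      (𝓝 (a * (0 + 0))) :=
    ((tendsto_pow_const_div_const_pow_of_one_lt 1 hq).add
      (tendsto_pow_const_div_const_pow_of_one_lt 0 hq)).const_mul a
  rw [add_zero, mul_zero] at hlim
  filter_upwards [hlim.eventually_lt_const one_pos] with m hm
  rwa [pow_one, pow_zero, ← add_div, mul_div_assoc', div_lt_one (by positivity)] at hm

lemma eventually_rpow_le_ncard_nonzeroLetters (hβ : 1 < β) {r : ℝ} (hr₀ : 0 ≤ r) (hr₁ : r < 1) :
    ∀ᶠ m : ℕ in atTop, β ^ (m * r) ≤ (nonzeroLetters β m).ncard := by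
  have hβ0 : 0 < β := by linarith
  filter_upwards [eventually_mul_succ_lt_pow (a := 3) (Real.one_lt_rpow hβ (sub_pos.2 hr₁))]
    with m hm
  by_contra! hlt
  have hone : 1 ≤ β ^ (m * r) := Real.one_le_rpow hβ.le (by positivity)
  have hfull : ({c | IsFull β m c}.ncard : ℝ) ≤ 3 * β ^ (m * r) := by
    have hcard : ({c | IsFull β m c}.ncard : ℝ) ≤ (nonzeroLetters β m).ncard + 2 := by
      exact_mod_cast ncard_isFull_le_ncard_nonzeroLetters_add_two hβ m
    linarith
  have hsplit : (β ^ (1 - r)) ^ m * β ^ (m * r) = β ^ m := by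
    rw [← Real.rpow_natCast, ← Real.rpow_mul hβ0.le, ← Real.rpow_add hβ0, ← Real.rpow_natCast]
    ring_nf
  refine lt_irrefl (β ^ m) ?_
  calc β ^ m ≤ (m + 1) * {c | IsFull β m c}.ncard := pow_le_mul_ncard_isFull hβ m
    _ ≤ (m + 1) * (3 * β ^ (m * r)) := by gcongr
    _ = 3 * (m + 1) * β ^ (m * r) := by ring
    _ < (β ^ (1 - r)) ^ m * β ^ (m * r) := by gcongr
    _ = β ^ m := hsplit

end FullIntervals

/-- The real number with base `B` digits `c i ∈ [0, 1 - 2 / B]`. For `B = β ^ m` and letters `c i`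
this is the point of `[0, 1)` whose `β`-expansion concatenates the blocks of `m` digits of the
`c i`. -/
def code (B : ℝ) (c : ℕ → ℝ) : ℝ := ∑' i, c i / B ^ i

section Code

variable {B : ℝ} {c d : ℕ → ℝ}

lemma summable_code (hB : 1 < B) (hc : ∀ i, c i ∈ Icc 0 (1 - 2 / B)) :
    Summable fun i => c i / B ^ i := by
  have hB0 : 0 < B := one_pos.trans hB
  refine .of_nonneg_of_le (fun i => div_nonneg (hc i).1 (by positivity)) (fun i => ?_)
    ((summable_geometric_of_lt_one (inv_nonneg.2 hB0.le) (inv_lt_one_of_one_lt₀ hB)).mul_left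
      (1 - 2 / B))
  rw [inv_pow, div_eq_mul_inv]
  gcongr
  exact (hc i).2

lemma code_eq (hB : 1 < B) (hc : ∀ i, c i ∈ Icc 0 (1 - 2 / B)) :
    code B c = c 0 + code B (fun i => c (i + 1)) / B := by
  rw [code, (summable_code hB hc).tsum_eq_zero_add, code, ← tsum_div_const]
  simp only [pow_zero, div_one, pow_succ, div_div]

lemma code_mem_Icc (hB : 1 < B) (hc : ∀ i, c i ∈ Icc 0 (1 - 2 / B)) :
    code B c ∈ Icc 0 (1 - 1 / B) := by
  have hB0 : 0 < B := one_pos.trans hB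
  have hinv : 1 / B < 1 := (div_lt_one hB0).2 hB
  have hgeom := (hasSum_geometric_of_lt_one (by positivity) hinv).mul_left (1 - 2 / B)
  refine ⟨tsum_nonneg fun i => div_nonneg (hc i).1 (by positivity), ?_⟩
  calc code B c ≤ (1 - 2 / B) * (1 - 1 / B)⁻¹ := by
        refine hasSum_le (fun i => ?_) (summable_code hB hc).hasSum hgeom
        rw [one_div, inv_pow, div_eq_mul_inv]
        gcongr
        exact (hc i).2
    _ ≤ 1 - 1 / B := by
        rw [← div_eq_mul_inv, div_le_iff₀ (sub_pos.2 hinv)]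
        nlinarith [sq_nonneg (1 / B), show 2 / B = 2 * (1 / B) by ring]

lemma code_mem_Ico (hB : 1 < B) (hc : ∀ i, c i ∈ Icc 0 (1 - 2 / B)) :
    code B c ∈ Ico (0 : ℝ) 1 := by
  have hinv : 0 < 1 / B := one_div_pos.2 (one_pos.trans hB)
  obtain ⟨hnonneg, hle⟩ := code_mem_Icc hB hc
  exact ⟨hnonneg, by linarith⟩

lemma code_sub_code_of_eq (hB : 1 < B) (hc : ∀ i, c i ∈ Icc 0 (1 - 2 / B))
    (hd : ∀ i, d i ∈ Icc 0 (1 - 2 / B)) {k : ℕ} (h : ∀ i < k, c i = d i) :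
    code B c - code B d =
      (code B (fun i => c (i + k)) - code B (fun i => d (i + k))) / B ^ k := by
  induction k with
  | zero => simp
  | succ k ih =>
    rw [ih fun i hi => h i (by omega), code_eq hB fun i => hc (i + k),
      code_eq hB fun i => hd (i + k), zero_add, h k k.lt_succ_self, add_sub_add_left_eq_sub,
      ← sub_div, div_div, ← pow_succ']
    simp only [add_assoc, add_comm 1 k]

lemma inv_le_abs_code_sub (hB : 1 < B) (hc : ∀ i, c i ∈ Icc 0 (1 - 2 / B))
    (hd : ∀ i, d i ∈ Icc 0 (1 - 2 / B)) {k : ℕ} (h : ∀ i < k, c i = d i)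
    (hk : 1 / B ≤ |c k - d k|) : 1 / B ^ (k + 2) ≤ |code B c - code B d| := by
  have hB0 : 0 < B := one_pos.trans hB
  obtain ⟨hc₀, hc₁⟩ := code_mem_Icc hB fun i => hc (i + 1 + k)
  obtain ⟨hd₀, hd₁⟩ := code_mem_Icc hB fun i => hd (i + 1 + k)
  set s := code B fun i => c (i + 1 + k)
  set t := code B fun i => d (i + 1 + k)
  have htail : |(s - t) / B| ≤ 1 / B - 1 / B ^ 2 := by
    have habs : |s - t| ≤ 1 - 1 / B := abs_sub_le_iff.2 ⟨by linarith, by linarith⟩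
    calc |(s - t) / B| = |s - t| / B := by rw [abs_div, abs_of_pos hB0]
      _ ≤ (1 - 1 / B) / B := by gcongr
      _ = 1 / B - 1 / B ^ 2 := by field_simp
  have hsplit : code B (fun i => c (i + k)) - code B (fun i => d (i + k)) =
      (c k - d k) + (s - t) / B := by
    rw [code_eq hB fun i => hc (i + k), code_eq hB fun i => hd (i + k), zero_add]
    ring
  rw [code_sub_code_of_eq hB hc hd h, hsplit, abs_div, abs_of_pos (pow_pos hB0 k), add_comm k 2,
    pow_add, ← div_div]
  gcongr
  linarith [abs_sub_abs_le_abs_add (c k - d k) ((s - t) / B)]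

end Code

section CodedExpansions

variable {β : ℝ} {m : ℕ} {c : ℕ → ℝ}

lemma ne_zero_of_two_le_pow (h₂ : 2 ≤ β ^ m) : m ≠ 0 := by
  rintro rfl
  norm_num at h₂

lemma isLetter_zero (hβ : 1 < β) (h₂ : 2 ≤ β ^ m) : IsLetter β m 0 :=
  ⟨isFull_zero hβ m, sub_nonneg.2 ((div_le_one (by linarith)).2 h₂)⟩

lemma iterate_T_code (hβ : 1 < β) (hm : m ≠ 0) (hc : ∀ i, IsLetter β m (c i)) (k : ℕ) :
    (T β)^[m * k] (code (β ^ m) c) = code (β ^ m) fun i => c (i + k) := by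
  have hB : 1 < β ^ m := one_lt_pow₀ hβ hm
  induction k with
  | zero => simp
  | succ k ih =>
    rw [mul_add_one, add_comm, Function.iterate_add_apply, ih,
      code_eq hB fun i => (hc (i + k)).mem_Icc,
      (hc (0 + k)).1.iterate_T_add_div (code_mem_Ico hB fun i => (hc (i + 1 + k)).mem_Icc)]
    simp only [add_assoc, add_comm 1 k]

lemma digitSeq_code (hβ : 1 < β) (hm : m ≠ 0) (hc : ∀ i, IsLetter β m (c i)) (k : ℕ) {s : ℕ}
    (hs : s < m) : digitSeq β (code (β ^ m) c) (m * k + s) = digitSeq β (c k) s := by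
  have hB : 1 < β ^ m := one_lt_pow₀ hβ hm
  rw [← digitSeq_iterate, iterate_T_code hβ hm hc, code_eq hB fun i => (hc (i + k)).mem_Icc,
    (hc (0 + k)).1.digitSeq_add_div (code_mem_Ico hB fun i => (hc (i + 1 + k)).mem_Icc) hs,
    zero_add]

lemma digitSeq_code_eq_div_mod (hβ : 1 < β) (hm : m ≠ 0) (hc : ∀ i, IsLetter β m (c i))
    (p : ℕ) : digitSeq β (code (β ^ m) c) p = digitSeq β (c (p / m)) (p % m) := by
  conv_lhs => rw [← Nat.div_add_mod p m]
  exact digitSeq_code hβ hm hc _ (Nat.mod_lt _ (by omega))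

lemma eq_zero_of_digitSeq_code (hβ : 1 < β) (hm : m ≠ 0) (hc : ∀ i, IsLetter β m (c i)) {k : ℕ}
    (h : ∀ s < m, digitSeq β (code (β ^ m) c) (m * k + s) = 0) : c k = 0 := by
  by_contra hne
  obtain ⟨s, hs, hdigit⟩ := (hc k).exists_digitSeq_ne_zero (one_pos.trans hβ) hne
  exact hdigit (digitSeq_code hβ hm hc k hs ▸ h s hs)

end CodedExpansions

/-- The positions overwritten by the insertions: for `l ≥ 4` the `l`-th one occupies the `l + 1`
places from `P l` on. Shorter insertions could not hold the marker of `withMarker` together with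
a nonzero term. -/
def Inserted (P : ℕ → ℕ) (j : ℕ) : Prop := ∃ l, 4 ≤ l ∧ P l ≤ j ∧ j ≤ P l + l

/-- Consecutive insertions are disjoint and do not touch. -/
def Separated (P : ℕ → ℕ) : Prop := ∀ l, P l + l + 2 ≤ P (l + 1)

open Classical in
/-- The number of places below `j` that are not overwritten. -/
def freeCount (P : ℕ → ℕ) (j : ℕ) : ℕ := Nat.count (fun i => ¬ Inserted P i) j

/-- The sequence `v` preceded by the marker `000`. -/
def withMarker {α : Type*} [Zero α] (v : ℕ → α) (i : ℕ) : α := if i < 3 then 0 else v (i - 3)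

open Classical in
/-- The sequence `u` spread over the free places; at `P l` the first `l` terms of `Y` are inserted,
followed by a `0`. -/
def insertPrefixes {α : Type*} [Zero α] (P : ℕ → ℕ) (Y u : ℕ → α) (j : ℕ) : α :=
  if h : Inserted P j then
    if j - P h.choose < h.choose then Y (j - P h.choose) else 0
  else u (freeCount P j)

section Insertions

variable {α : Type*} [Zero α] {P : ℕ → ℕ} {Y u u' v : ℕ → α}

lemma Separated.add_add_two_le (hP : Separated P) {l k : ℕ} (hlk : l < k) : P l + l + 2 ≤ P k := by
  induction k, hlk using Nat.le_induction with
  | base => exact hP l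
  | succ k _ ih => exact ih.trans (by linarith [hP k])

lemma Separated.monotone (hP : Separated P) : Monotone P :=
  monotone_nat_of_le_succ fun l => by linarith [hP l]

lemma Separated.eq_of_add_eq_add (hP : Separated P) {l k i j : ℕ} (hi : i ≤ l + 1) (hj : j ≤ k + 1)
    (h : P l + i = P k + j) : l = k := by
  rcases lt_trichotomy l k with hlt | heq | hlt
  · have := hP.add_add_two_le hlt
    omega
  · exact heq
  · have := hP.add_add_two_le hlt
    omega

lemma forall_withMarker {p : α → Prop} (h₀ : p 0) (hv : ∀ i, p (v i)) (i : ℕ) :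
    p (withMarker v i) := by
  rw [withMarker]
  split_ifs
  exacts [h₀, hv _]

lemma withMarker_of_lt {i : ℕ} (hi : i < 3) : withMarker v i = 0 := if_pos hi

lemma withMarker_add_three (i : ℕ) : withMarker v (i + 3) = v i := if_neg (by omega)

lemma withMarker_ne_zero (hv : ∀ i, v i ≠ 0) {i : ℕ} (hi : 3 ≤ i) : withMarker v i ≠ 0 := by
  obtain ⟨j, rfl⟩ := Nat.exists_eq_add_of_le' hi
  rw [withMarker_add_three]
  exact hv j

lemma forall_insertPrefixes {p : α → Prop} (h₀ : p 0) (hY : ∀ i, p (Y i)) (hu : ∀ i, p (u i))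
    (i : ℕ) : p (insertPrefixes P Y u i) := by
  rw [insertPrefixes]
  split_ifs
  exacts [hY _, h₀, hu _]

lemma insertPrefixes_add (hP : Separated P) {l i : ℕ} (hl : 4 ≤ l) (hi : i ≤ l) :
    insertPrefixes P Y u (P l + i) = if i < l then Y i else 0 := by
  have h : Inserted P (P l + i) := ⟨l, hl, by omega, by omega⟩
  obtain ⟨-, hle, hge⟩ := h.choose_spec
  have hchoose : h.choose = l := by
    obtain ⟨j, hj⟩ := Nat.exists_eq_add_of_le hle
    exact hP.eq_of_add_eq_add (i := j) (j := i) (by omega) (by omega) hj.symm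
  rw [insertPrefixes, dif_pos h, hchoose, Nat.add_sub_cancel_left]

lemma insertPrefixes_add_of_lt (hP : Separated P) {l i : ℕ} (hl : 4 ≤ l) (hi : i < l) :
    insertPrefixes P Y u (P l + i) = Y i := by
  rw [insertPrefixes_add hP hl hi.le, if_pos hi]

lemma insertPrefixes_add_self (hP : Separated P) {l : ℕ} (hl : 4 ≤ l) :
    insertPrefixes P Y u (P l + l) = 0 := by
  rw [insertPrefixes_add hP hl le_rfl, if_neg l.lt_irrefl]

lemma insertPrefixes_of_free {j : ℕ} (h : ¬ Inserted P j) :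
    insertPrefixes P Y u j = u (freeCount P j) := dif_neg h

lemma insertPrefixes_eq_zero (hP : Separated P) (hu : ∀ i, u i ≠ 0) (hY : ∀ i, 3 ≤ i → Y i ≠ 0)
    {j : ℕ} (hj : insertPrefixes P Y u j = 0) :
    ∃ l i, 4 ≤ l ∧ j = P l + i ∧ (i < 3 ∨ i = l) := by
  by_cases hins : Inserted P j
  · obtain ⟨l, hl, hle, hge⟩ := hins
    obtain ⟨i, rfl⟩ := Nat.exists_eq_add_of_le hle
    refine ⟨l, i, hl, rfl, or_iff_not_imp_left.2 fun hi => ?_⟩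
    by_contra hne
    rw [insertPrefixes_add_of_lt hP hl (by omega)] at hj
    exact hY i (by omega) hj
  · rw [insertPrefixes_of_free hins] at hj
    exact absurd hj (hu _)

lemma insertPrefixes_eq_zero_of_succ (hP : Separated P) (hu : ∀ i, u i ≠ 0)
    (hY : ∀ i, 3 ≤ i → Y i ≠ 0) {j : ℕ} (hj : insertPrefixes P Y u j = 0)
    (hj' : insertPrefixes P Y u (j + 1) = 0) : ∃ l, 4 ≤ l ∧ (j = P l ∨ j = P l + 1) := by
  obtain ⟨l, i, hl, rfl, hi⟩ := insertPrefixes_eq_zero hP hu hY hj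
  obtain ⟨k, i', hk, heq, hi'⟩ := insertPrefixes_eq_zero hP hu hY hj'
  obtain rfl : l = k := hP.eq_of_add_eq_add (i := i + 1) (by omega) (by omega) heq
  exact ⟨l, hl, by omega⟩

lemma eq_of_insertPrefixes_eq {Y' : ℕ → α} {i : ℕ}
    (h : ∀ j < i, insertPrefixes P Y u j = insertPrefixes P Y' u' j) :
    ∀ k < freeCount P i, u k = u' k := by
  classical
  intro k hk
  have hcard (hf : {j | ¬ Inserted P j}.Finite) : k < hf.toFinset.card :=
    hk.trans_le (Nat.count_le_card hf i)
  have hfree : ¬ Inserted P (Nat.nth (fun j => ¬ Inserted P j) k) := Nat.nth_mem k hcard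
  have hcount : freeCount P (Nat.nth (fun j => ¬ Inserted P j) k) = k := Nat.count_nth hcard
  have heq := h _ (Nat.nth_lt_of_lt_count hk)
  rwa [insertPrefixes_of_free hfree, insertPrefixes_of_free hfree, hcount] at heq

lemma freeCount_le (i : ℕ) : freeCount P i ≤ i := by
  classical
  exact Nat.count_le _

lemma le_freeCount_add (hpow : ∀ l, 2 ^ l ≤ P l) (i : ℕ) :
    i ≤ freeCount P i + (Nat.log 2 i + 1) ^ 2 := by
  classical
  have hsub : (Finset.range i).filter (fun j => ¬ ¬ Inserted P j) ⊆
      (Finset.range (Nat.log 2 i + 1) ×ˢ Finset.range (Nat.log 2 i + 1)).image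
        fun p => P p.1 + p.2 := by
    intro j hj
    simp only [Finset.mem_filter, Finset.mem_range, not_not] at hj
    obtain ⟨hji, l, -, hle, hge⟩ := hj
    have hlog : l ≤ Nat.log 2 i := Nat.le_log_of_pow_le one_lt_two ((hpow l).trans (by omega))
    simp only [Finset.mem_image, Finset.mem_product, Finset.mem_range, Prod.exists]
    exact ⟨l, j - P l, ⟨by omega, by omega⟩, by omega⟩
  have hcard := (Finset.card_le_card hsub).trans Finset.card_image_le
  rw [Finset.card_product, Finset.card_range, ← sq] at hcard
  have hsplit := Finset.card_filter_add_card_filter_not (s := Finset.range i)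
    fun j => ¬ Inserted P j
  rw [Finset.card_range] at hsplit
  rw [freeCount, Nat.count_eq_card_filter_range]
  omega

lemma tendsto_natLog_atTop {b : ℕ} (hb : 1 < b) : Tendsto (Nat.log b) atTop atTop :=
  tendsto_atTop_mono' atTop (f₁ := fun n => Nat.log b n) .rfl
    (tendsto_atTop_atTop_of_monotone Nat.log_monotone fun n => ⟨b ^ n, (Nat.log_pow hb n).ge⟩)

lemma tendsto_log_add_one_sq_div :
    Tendsto (fun i : ℕ => ((Nat.log 2 i : ℝ) + 1) ^ 2 / i) atTop (𝓝 0) := by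
  have hpoly : Tendsto (fun n : ℕ => 2 * (((n + 1 : ℕ) : ℝ) ^ 2 / 2 ^ (n + 1))) atTop (𝓝 0) := by
    simpa using ((tendsto_add_atTop_iff_nat 1).2
      (tendsto_pow_const_div_const_pow_of_one_lt 2 (one_lt_two (α := ℝ)))).const_mul 2
  refine squeeze_zero' (.of_forall fun i => by positivity) ?_
    (hpoly.comp (tendsto_natLog_atTop one_lt_two))
  filter_upwards [eventually_gt_atTop 0] with i hi
  have hle : (2 : ℝ) ^ Nat.log 2 i ≤ i := by exact_mod_cast Nat.pow_log_le_self 2 hi.ne'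
  calc ((Nat.log 2 i : ℝ) + 1) ^ 2 / i ≤ ((Nat.log 2 i : ℝ) + 1) ^ 2 / 2 ^ Nat.log 2 i := by gcongr
    _ = 2 * (((Nat.log 2 i + 1 : ℕ) : ℝ) ^ 2 / 2 ^ (Nat.log 2 i + 1)) := by
      push_cast; rw [pow_succ (2 : ℝ)]; field_simp

lemma tendsto_freeCount_div (hpow : ∀ l, 2 ^ l ≤ P l) :
    Tendsto (fun i : ℕ => (freeCount P i : ℝ) / i) atTop (𝓝 1) := by
  have hlower : Tendsto (fun i : ℕ => 1 - ((Nat.log 2 i : ℝ) + 1) ^ 2 / i) atTop (𝓝 1) := by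
    simpa only [sub_zero] using tendsto_log_add_one_sq_div.const_sub 1
  refine tendsto_of_tendsto_of_tendsto_of_le_of_le' hlower tendsto_const_nhds ?_ ?_ <;>
  filter_upwards [eventually_gt_atTop 0] with i hi
  · have hi' : (0 : ℝ) < i := by exact_mod_cast hi
    have hle : (i : ℝ) ≤ freeCount P i + ((Nat.log 2 i : ℝ) + 1) ^ 2 := by
      exact_mod_cast le_freeCount_add hpow i
    rw [one_sub_div hi'.ne']
    gcongr
    linarith
  · have hi' : (0 : ℝ) < i := by exact_mod_cast hi
    rw [div_le_one hi']
    exact_mod_cast freeCount_le i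

end Insertions

/-- The pair `(x, y)` in which `y` is written with the letters `v` behind the marker, and `x` with
the letters `u` interrupted by the prefixes of `y`. -/
def insertionPair (β : ℝ) (m : ℕ) (P : ℕ → ℕ) (u v : ℕ → ℝ) : ℝ × ℝ :=
  (code (β ^ m) (insertPrefixes P (withMarker v) u), code (β ^ m) (withMarker v))

/-- The pairs `insertionPair β m P u v` with arbitrary nonzero letters `u i` and `v i`, on which
the waiting times are governed by `P` alone. -/
def insertionSet (β : ℝ) (m : ℕ) (P : ℕ → ℕ) : Set (ℝ × ℝ) :=
  {p | ∃ u v, (∀ i, u i ∈ nonzeroLetters β m) ∧ (∀ i, v i ∈ nonzeroLetters β m) ∧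
    insertionPair β m P u v = p}

section WaitingTimes

variable {β : ℝ} {m : ℕ} {P : ℕ → ℕ}

lemma mem_basicInterval_iff {x y : ℝ} (hx : x ∈ Ico (0 : ℝ) 1) (n k : ℕ) :
    (T β)^[k] x ∈ basicInterval β n y ↔ ∀ i < n, digitSeq β x (k + i) = digitSeq β y i := by
  simp only [basicInterval, mem_ofPred_eq, iterate_T_mem_Ico hx k, true_and, ← digitSeq_iterate]
  exact ⟨fun h i hi => h (i + 1) (by omega) (by omega), fun h i _ _ => h (i - 1) (by omega)⟩

lemma digitSeq_code_insertPrefixes {Y u : ℕ → ℝ} (hβ : 1 < β) (h₂ : 2 ≤ β ^ m)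
    (hP : Separated P) (hY : ∀ i, IsLetter β m (Y i)) (hu : ∀ i, IsLetter β m (u i)) {l i : ℕ}
    (hl : 4 ≤ l) (hi : i < m * l) :
    digitSeq β (code (β ^ m) (insertPrefixes P Y u)) (m * P l + i) =
      digitSeq β (code (β ^ m) Y) i := by
  have hm : m ≠ 0 := by rintro rfl; omega
  rw [digitSeq_code_eq_div_mod hβ hm (forall_insertPrefixes (isLetter_zero hβ h₂) hY hu),
    digitSeq_code_eq_div_mod hβ hm hY, Nat.mul_add_div (by omega), Nat.mul_add_mod,
    insertPrefixes_add_of_lt hP hl (Nat.div_lt_of_lt_mul hi)]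

lemma exists_first_digitSeq_ne_zero_code {c : ℕ → ℝ} (hβ : 1 < β) (hm : m ≠ 0)
    (hc : ∀ i, IsLetter β m (c i)) {k : ℕ} (h₀ : ∀ i < k, c i = 0) (hk : c k ≠ 0) :
    ∃ N, m * k ≤ N ∧ N < m * (k + 1) ∧ digitSeq β (code (β ^ m) c) N ≠ 0 ∧
      ∀ i < N, digitSeq β (code (β ^ m) c) i = 0 := by
  classical
  have hex : ∃ N, digitSeq β (code (β ^ m) c) N ≠ 0 := by
    by_contra! hzero
    exact hk (eq_zero_of_digitSeq_code hβ hm hc fun s _ => hzero _)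
  refine ⟨Nat.find hex, ?_, ?_, Nat.find_spec hex, fun i hi => not_not.1 (Nat.find_min hex hi)⟩
  · refine (Nat.le_find_iff hex _).2 fun i hi => not_not.2 ?_
    rw [digitSeq_code_eq_div_mod hβ hm hc, h₀ _ (Nat.div_lt_of_lt_mul hi), digitSeq_zero]
  · by_contra! hle
    refine hk (eq_zero_of_digitSeq_code hβ hm hc fun s hs => not_not.1 (Nat.find_min hex ?_))
    rw [mul_add_one] at hle
    omega

lemma exists_two_zero_of_digitSeq_code_eq_zero {c : ℕ → ℝ} (hβ : 1 < β) (hm : m ≠ 0)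
    (hc : ∀ i, IsLetter β m (c i)) {k : ℕ}
    (h : ∀ i < m * 3, digitSeq β (code (β ^ m) c) (k + i) = 0) :
    ∃ j, k ≤ m * j ∧ m * j < k + m ∧ c j = 0 ∧ c (j + 1) = 0 := by
  obtain ⟨j, hkj, hjk⟩ : ∃ j, k ≤ m * j ∧ m * j < k + m := by
    have hdiv := Nat.div_add_mod (k + m - 1) m
    have hmod := Nat.mod_lt (k + m - 1) (Nat.pos_of_ne_zero hm)
    exact ⟨(k + m - 1) / m, by omega, by omega⟩
  refine ⟨j, hkj, hjk, ?_, ?_⟩ <;> refine eq_zero_of_digitSeq_code hβ hm hc fun s hs => ?_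
  · convert h (m * j + s - k) (by omega) using 2
    omega
  · convert h (m * (j + 1) + s - k) (by rw [mul_add_one]; omega) using 2
    rw [mul_add_one]
    omega

lemma eq_of_first_ne_zero {α : Type*} [Zero α] {f g : ℕ → α} {a b N : ℕ}
    (hg₀ : ∀ i < N, g i = 0) (hgN : g N ≠ 0) (ha : ∀ i ≤ N, f (a + i) = g i)
    (hb : ∀ i ≤ N, f (b + i) = g i) (hab : a ≤ b + N) (hba : b ≤ a + N) : a = b := by
  wlog hle : a ≤ b generalizing a b
  · exact (this hb ha hba hab (le_of_not_ge hle)).symm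
  by_contra hne
  obtain ⟨i, hi⟩ := Nat.exists_eq_add_of_le hba
  refine hgN ?_
  rw [← ha N le_rfl, hi, hb i (by omega), hg₀ i (by omega)]

lemma exists_eq_mul_of_digitSeq_code_eq {u v : ℕ → ℝ} (hβ : 1 < β) (h₂ : 2 ≤ β ^ m)
    (hP : Separated P) (hu : ∀ i, u i ∈ nonzeroLetters β m)
    (hv : ∀ i, v i ∈ nonzeroLetters β m) {k n : ℕ} (hn : m * 4 ≤ n)
    (h : ∀ i < n, digitSeq β (code (β ^ m) (insertPrefixes P (withMarker v) u)) (k + i) =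
      digitSeq β (code (β ^ m) (withMarker v)) i) :
    ∃ l, 4 ≤ l ∧ k = m * P l ∧ n < m * (l + 1) := by
  have hm := ne_zero_of_two_le_pow h₂
  set Y := withMarker v
  set X := insertPrefixes P Y u
  have hY : ∀ i, IsLetter β m (Y i) := forall_withMarker (isLetter_zero hβ h₂) fun i => (hv i).1
  have hX : ∀ i, IsLetter β m (X i) :=
    forall_insertPrefixes (isLetter_zero hβ h₂) hY fun i => (hu i).1
  have hY₀ : ∀ i, 3 ≤ i → Y i ≠ 0 := fun i => withMarker_ne_zero fun i => (hv i).2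
  obtain ⟨N, hN₃, hN₄, hyN, hy₀⟩ := exists_first_digitSeq_ne_zero_code hβ hm hY
    (fun i hi => withMarker_of_lt hi) (hY₀ 3 le_rfl)
  obtain ⟨j, hkj, hjk, hj, hj'⟩ := exists_two_zero_of_digitSeq_code_eq_zero hβ hm hX (k := k)
    fun i hi => (h i (by omega)).trans (hy₀ i (by omega))
  obtain ⟨l, hl, hjl⟩ := insertPrefixes_eq_zero_of_succ hP (fun i => (hu i).2) hY₀ hj hj'
  have hml : m * 4 ≤ m * l := Nat.mul_le_mul_left m hl
  have hk : k = m * P l := by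
    refine eq_of_first_ne_zero hy₀ hyN (fun i hi => h i (by omega))
      (fun i hi => digitSeq_code_insertPrefixes hβ h₂ hP hY (fun i => (hu i).1) hl (by omega))
      ?_ ?_ <;> rcases hjl with rfl | rfl <;> rw [mul_add_one] at * <;> omega
  refine ⟨l, hl, hk, ?_⟩
  by_contra! hle
  refine hY₀ l (by omega) (eq_zero_of_digitSeq_code hβ hm hY fun s hs => ?_)
  rw [← h _ (by rw [mul_add_one] at hle; omega), hk, ← add_assoc, ← mul_add,
    digitSeq_code hβ hm hX _ hs, show X (P l + l) = 0 from insertPrefixes_add_self hP hl,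
    digitSeq_zero]

lemma mem_Ico_of_mem_insertionSet (hβ : 1 < β) (h₂ : 2 ≤ β ^ m) {p : ℝ × ℝ}
    (hp : p ∈ insertionSet β m P) : p.1 ∈ Ico (0 : ℝ) 1 ∧ p.2 ∈ Ico (0 : ℝ) 1 := by
  have hm := ne_zero_of_two_le_pow h₂
  obtain ⟨u, v, hu, hv, rfl⟩ := hp
  have hY : ∀ i, IsLetter β m (withMarker v i) :=
    forall_withMarker (isLetter_zero hβ h₂) fun i => (hv i).1
  have hX := forall_insertPrefixes (P := P) (isLetter_zero hβ h₂) hY fun i => (hu i).1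
  have hB := one_lt_pow₀ hβ hm
  exact ⟨code_mem_Ico hB fun i => (hX i).mem_Icc, code_mem_Ico hB fun i => (hY i).mem_Icc⟩

lemma waitingTime_of_mem_insertionSet (hβ : 1 < β) (h₂ : 2 ≤ β ^ m)
    (hP : Separated P) {p : ℝ × ℝ} (hp : p ∈ insertionSet β m P) {l : ℕ} (hl : 4 ≤ l) :
    waitingTime β (m * l) p.1 p.2 = (m * P l : ℕ) := by
  have hm := ne_zero_of_two_le_pow h₂
  have hx := (mem_Ico_of_mem_insertionSet hβ h₂ hp).1
  obtain ⟨u, v, hu, hv, rfl⟩ := hp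
  have hY : ∀ i, IsLetter β m (withMarker v i) :=
    forall_withMarker (isLetter_zero hβ h₂) fun i => (hv i).1
  refine le_antisymm (iInf₂_le (m * P l) ⟨?_, ?_⟩) (le_iInf₂ fun k hk => ?_)
  · obtain ⟨l', -, rfl, hlt⟩ := exists_eq_mul_of_digitSeq_code_eq hβ h₂ hP hu hv
      (Nat.mul_le_mul_left m hl) ((mem_basicInterval_iff hx _ _).1 hk.2)
    exact_mod_cast Nat.mul_le_mul_left m
      (hP.monotone (Nat.lt_succ_iff.1 (Nat.lt_of_mul_lt_mul_left hlt)))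
  · have := hP.add_add_two_le (show 0 < l by omega)
    exact Nat.mul_pos (Nat.pos_of_ne_zero hm) (by omega)
  · exact (mem_basicInterval_iff hx _ _).2 fun i hi =>
      digitSeq_code_insertPrefixes hβ h₂ hP hY (fun i => (hu i).1) hl hi

lemma monotone_waitingTime (x y : ℝ) : Monotone fun n => waitingTime β n x y := fun _ _ hnk =>
  le_iInf₂ fun k hk => iInf₂_le k ⟨hk.1, hk.2.1, fun i hi hin => hk.2.2 i hi (hin.trans hnk)⟩

lemma one_le_waitingTime (n : ℕ) (x y : ℝ) : 1 ≤ waitingTime β n x y :=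
  le_iInf₂ fun k hk => by exact_mod_cast hk.1

lemma waitingRate_eq_coe {x y : ℝ} {n : ℕ} (h : waitingTime β n x y ≠ ⊤) :
    waitingRate β x y n = ((Real.log (waitingTime β n x y).toNat / n : ℝ) : EReal) := by
  have hpos : (waitingTime β n x y).toNat ≠ 0 :=
    ENat.toNat_eq_zero.not.2 (not_or.2 ⟨(one_pos.trans_le (one_le_waitingTime n x y)).ne', h⟩)
  obtain ⟨w, hw⟩ := ENat.ne_top_iff_exists.1 h
  rw [← hw, ENat.toNat_natCast] at hpos ⊢
  rw [waitingRate, ← hw, EReal.coe_div, ENat.toENNReal_coe,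
    ENNReal.log_pos_real (Nat.cast_ne_zero.2 hpos) (ENNReal.natCast_ne_top w),
    ENNReal.toReal_natCast, EReal.coe_natCast]

lemma coe_mem_accPoints_iff {x y t : ℝ} (h : ∀ n, waitingTime β n x y ≠ ⊤) :
    (t : EReal) ∈ accPoints β x y ↔
      MapClusterPt t atTop fun n => Real.log (waitingTime β n x y).toNat / n := by
  have hrate : waitingRate β x y =
      Real.toEReal ∘ fun n => Real.log (waitingTime β n x y).toNat / n :=
    funext fun n => waitingRate_eq_coe (h n)
  rw [accPoints, mem_ofPred_eq, hrate, MapClusterPt, ← map_map]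
  exact EReal.isEmbedding_coe.isInducing.mapClusterPt_iff

lemma accPoints_subset_range_coe {x y b : ℝ} (h : ∀ n, waitingTime β n x y ≠ ⊤)
    (hb : ∀ᶠ n : ℕ in atTop, Real.log (waitingTime β n x y).toNat / n ≤ b) :
    accPoints β x y ⊆ range fun t : ℝ => (t : EReal) := by
  intro t ht
  have htb : t ∈ Icc ((0 : ℝ) : EReal) b := by
    refine isClosed_Icc.mem_of_mapClusterPt ht (hb.mono fun n hn => ?_)
    rw [waitingRate_eq_coe (h n)]
    exact ⟨EReal.coe_le_coe_iff.2 (div_nonneg (Real.log_natCast_nonneg _) n.cast_nonneg),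
      EReal.coe_le_coe_iff.2 hn⟩
  refine ⟨t.toReal, EReal.coe_toReal (ne_top_of_le_ne_top (EReal.coe_ne_top b) htb.2) ?_⟩
  exact ((EReal.bot_lt_coe 0).trans_le htb.1).ne'

end WaitingTimes

section Places

lemma two_le_exp_one : 2 ≤ Real.exp 1 := by linarith [Real.add_one_le_exp 1]

lemma two_pow_le_floor_exp {n : ℕ} {x : ℝ} (h : n ≤ x) : 2 ^ n ≤ ⌊Real.exp x⌋₊ := by
  refine Nat.le_floor ?_
  calc ((2 ^ n : ℕ) : ℝ) = 2 ^ n := by norm_cast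
    _ ≤ Real.exp 1 ^ n := by gcongr; exact two_le_exp_one
    _ = Real.exp n := by rw [← Real.exp_nat_mul, mul_one]
    _ ≤ Real.exp x := Real.exp_le_exp.2 h

lemma separated_floor_exp {E : ℕ → ℝ} (hE : ∀ l, l ≤ E l) (hstep : ∀ l, E l + 2 ≤ E (l + 1)) :
    Separated fun l => ⌊Real.exp (E l)⌋₊ := by
  refine fun l => Nat.le_floor ?_
  have hfloor : (⌊Real.exp (E l)⌋₊ : ℝ) ≤ Real.exp (E l) := Nat.floor_le (Real.exp_pos _).le
  calc ((⌊Real.exp (E l)⌋₊ + l + 2 : ℕ) : ℝ) = ⌊Real.exp (E l)⌋₊ + l + 2 := by push_cast; ring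
    _ ≤ Real.exp (E l) * 3 := by linarith [hE l, Real.add_one_le_exp (E l), Real.exp_pos (E l)]
    _ ≤ Real.exp (E l) * Real.exp 2 := by gcongr; linarith [Real.add_one_le_exp 2]
    _ = Real.exp (E l + 2) := (Real.exp_add _ _).symm
    _ ≤ Real.exp (E (l + 1)) := Real.exp_le_exp.2 (hstep l)

lemma abs_log_floor_exp_sub_le {x : ℝ} (hx : 0 ≤ x) : |Real.log ⌊Real.exp x⌋₊ - x| ≤ 1 := by
  have hone : (1 : ℝ) ≤ ⌊Real.exp x⌋₊ := by
    exact_mod_cast Nat.le_floor (by exact_mod_cast Real.one_le_exp hx)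
  have hpos : (0 : ℝ) < ⌊Real.exp x⌋₊ := one_pos.trans_le hone
  have hupper : Real.log ⌊Real.exp x⌋₊ ≤ x :=
    (Real.log_le_iff_le_exp hpos).2 (Nat.floor_le (Real.exp_pos x).le)
  have hlower : x ≤ 1 + Real.log ⌊Real.exp x⌋₊ := by
    rw [← Real.exp_le_exp, Real.exp_add, Real.exp_log hpos]
    nlinarith [Nat.lt_floor_add_one (Real.exp x), two_le_exp_one]
  exact abs_sub_le_iff.2 ⟨by linarith, by linarith⟩

/-- The place of the `l`-th insertion, chosen so that the waiting time for the first `m * l` digits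
is about `exp (m * l * h l)`. -/
def place (m : ℕ) (h : ℕ → ℝ) (l : ℕ) : ℕ := ⌊Real.exp (m * l * h l)⌋₊

variable {m : ℕ} {h : ℕ → ℝ} {a : ℝ}

lemma natCast_le_mul (hma : 4 ≤ m * a) (ha : ∀ n, a ≤ h n) (l : ℕ) : (l : ℝ) ≤ m * l * h l := by
  calc (l : ℝ) ≤ m * a * l := le_mul_of_one_le_left l.cast_nonneg (by linarith)
    _ ≤ m * h l * l := by gcongr; exact ha l
    _ = m * l * h l := by ring

lemma two_pow_le_place (hma : 4 ≤ m * a) (ha : ∀ n, a ≤ h n) (l : ℕ) : 2 ^ l ≤ place m h l :=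
  two_pow_le_floor_exp (natCast_le_mul hma ha l)

lemma mul_add_two_le_mul_succ (hma : 4 ≤ m * a) (ha : ∀ n, a ≤ h n)
    (hstep : ∀ n : ℕ, |h (n + 1) - h n| ≤ a / 2 / (n + 1)) (l : ℕ) :
    m * l * h l + 2 ≤ m * (l + 1 : ℕ) * h (l + 1) := by
  have hl : (0 : ℝ) < l + 1 := by positivity
  have hslow : -(a / 2) ≤ (l + 1) * (h (l + 1) - h l) := by
    rw [← div_le_iff₀' hl, neg_div]
    exact (abs_le.1 (hstep l)).1
  have hgain : m * (a / 2) ≤ m * ((l + 1) * (h (l + 1) - h l) + h l) := by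
    gcongr
    linarith [ha l]
  push_cast
  linarith

lemma separated_place (hma : 4 ≤ m * a) (ha : ∀ n, a ≤ h n)
    (hstep : ∀ n : ℕ, |h (n + 1) - h n| ≤ a / 2 / (n + 1)) : Separated (place m h) :=
  separated_floor_exp (natCast_le_mul hma ha) (mul_add_two_le_mul_succ hma ha hstep)

lemma tendsto_log_mul_place_div_sub (hma : 4 ≤ m * a) (ha : ∀ n, a ≤ h n) :
    Tendsto (fun q : ℕ => Real.log (m * place m h q : ℕ) / (m * q : ℕ) - h q) atTop (𝓝 0) := by
  have hm : 0 < m := Nat.pos_of_ne_zero (by rintro rfl; norm_num at hma)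
  refine squeeze_zero_norm' ?_ ((tendsto_const_nhds (x := Real.log m + 1)).div_atTop
    tendsto_natCast_atTop_atTop)
  filter_upwards [eventually_gt_atTop 0] with q hq
  have hmq : (0 : ℝ) < (m * q : ℕ) := by exact_mod_cast Nat.mul_pos hm hq
  have hplace : (place m h q : ℝ) ≠ 0 := by
    exact_mod_cast ((Nat.two_pow_pos q).trans_le (two_pow_le_place hma ha q)).ne'
  have hclose : |Real.log (place m h q) - m * q * h q| ≤ 1 :=
    abs_log_floor_exp_sub_le (q.cast_nonneg.trans (natCast_le_mul hma ha q))
  have hlog : 0 ≤ Real.log m := Real.log_natCast_nonneg m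
  calc ‖Real.log (m * place m h q : ℕ) / (m * q : ℕ) - h q‖
      = |Real.log m + (Real.log (place m h q) - m * q * h q)| / (m * q : ℕ) := by
        rw [Real.norm_eq_abs, ← abs_of_pos hmq, ← abs_div, abs_of_pos hmq, Nat.cast_mul,
          Real.log_mul (by positivity) hplace]
        congr 1
        push_cast
        field_simp
        ring
    _ ≤ (Real.log m + 1) / (m * q : ℕ) := by
        gcongr
        exact (abs_add_le _ _).trans (add_le_add (abs_of_nonneg hlog).le hclose)
    _ ≤ (Real.log m + 1) / q := by
        gcongr
        exact Nat.le_mul_of_pos_left q hm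

end Places

section PrescribedRate

variable {β a : ℝ} {m : ℕ} {P : ℕ → ℕ} {h : ℕ → ℝ} {J : Set ℝ} {p : ℝ × ℝ}

lemma waitingTime_ne_top_of_mem_insertionSet (hβ : 1 < β) (h₂ : 2 ≤ β ^ m)
    (hP : Separated P) (hp : p ∈ insertionSet β m P) (n : ℕ) : waitingTime β n p.1 p.2 ≠ ⊤ := by
  have hm := ne_zero_of_two_le_pow h₂
  have hle : n ≤ m * (n + 4) := by nlinarith [Nat.pos_of_ne_zero hm]
  refine ne_top_of_le_ne_top (ENat.natCast_ne_top _) ((monotone_waitingTime p.1 p.2 hle).trans_eq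
    (waitingTime_of_mem_insertionSet hβ h₂ hP hp (by omega)))

lemma tendsto_log_waitingTime_div_sub (hβ : 1 < β) (h₂ : 2 ≤ β ^ m) (hma : 4 ≤ m * a)
    (ha : ∀ n, a ≤ h n) (hstep : ∀ n : ℕ, |h (n + 1) - h n| ≤ a / 2 / (n + 1))
    (hp : p ∈ insertionSet β m (place m h)) :
    Tendsto (fun n : ℕ => Real.log (waitingTime β n p.1 p.2).toNat / n - h (n / m))
      atTop (𝓝 0) := by
  have hm := ne_zero_of_two_le_pow h₂
  have hP := separated_place hma ha hstep
  have hfin := waitingTime_ne_top_of_mem_insertionSet hβ h₂ hP hp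
  refine tendsto_div_sub_comp_div_of_tendsto (fun k n hkn => ?_)
    (fun n => Real.log_natCast_nonneg _) hm (tendsto_succ_sub_of_abs_le hstep) ?_
  · have hpos : 0 < (waitingTime β k p.1 p.2).toNat :=
      ENat.toNat_pos (one_pos.trans_le (one_le_waitingTime k p.1 p.2)).ne' (hfin k)
    refine Real.log_le_log (by exact_mod_cast hpos) ?_
    exact_mod_cast ENat.toNat_le_toNat (monotone_waitingTime p.1 p.2 hkn) (hfin n)
  · refine (tendsto_log_mul_place_div_sub hma ha).congr' ?_
    filter_upwards [eventually_ge_atTop 4] with q hq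
    rw [waitingTime_of_mem_insertionSet hβ h₂ hP hp hq, ENat.toNat_natCast]

lemma coe_mem_accPoints_iff_mapClusterPt (hβ : 1 < β) (h₂ : 2 ≤ β ^ m) (hma : 4 ≤ m * a)
    (ha : ∀ n, a ≤ h n) (hstep : ∀ n : ℕ, |h (n + 1) - h n| ≤ a / 2 / (n + 1))
    (hp : p ∈ insertionSet β m (place m h)) {t : ℝ} :
    (t : EReal) ∈ accPoints β p.1 p.2 ↔ MapClusterPt t atTop h := by
  have hm := ne_zero_of_two_le_pow h₂
  rw [coe_mem_accPoints_iff (waitingTime_ne_top_of_mem_insertionSet hβ h₂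
      (separated_place hma ha hstep) hp),
    mapClusterPt_iff_of_tendsto_sub (tendsto_log_waitingTime_div_sub hβ h₂ hma ha hstep hp),
    mapClusterPt_comp_div_iff hm]

lemma accPoints_subset_range_coe_of_bddAbove (hβ : 1 < β) (h₂ : 2 ≤ β ^ m) (hma : 4 ≤ m * a)
    (ha : ∀ n, a ≤ h n) (hstep : ∀ n : ℕ, |h (n + 1) - h n| ≤ a / 2 / (n + 1))
    (hp : p ∈ insertionSet β m (place m h)) (hbdd : BddAbove (range h)) :
    accPoints β p.1 p.2 ⊆ range fun t : ℝ => (t : EReal) := by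
  obtain ⟨b, hb⟩ := hbdd
  refine accPoints_subset_range_coe (b := b + 1) (waitingTime_ne_top_of_mem_insertionSet hβ h₂
    (separated_place hma ha hstep) hp) ?_
  filter_upwards [(tendsto_log_waitingTime_div_sub hβ h₂ hma ha hstep hp).eventually_lt_const
    one_pos] with n hn
  linarith [hb (mem_range_self (n / m))]

lemma insertionSet_subset_accLevelSet (hβ : 1 < β) (h₂ : 2 ≤ β ^ m) (hma : 4 ≤ m * a)
    (ha : ∀ n, a ≤ h n) (hstep : ∀ n : ℕ, |h (n + 1) - h n| ≤ a / 2 / (n + 1))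
    (hJ : ∀ t, MapClusterPt t atTop h ↔ t ∈ J) :
    insertionSet β m (place m h) ⊆ accLevelSet β J := by
  intro p hp
  obtain ⟨hx, hy⟩ := mem_Ico_of_mem_insertionSet hβ h₂ hp
  exact ⟨hx, hy, ext fun t =>
    (coe_mem_accPoints_iff_mapClusterPt hβ h₂ hma ha hstep hp).trans (hJ t)⟩

lemma insertionSet_subset_extAccLevelSet (hβ : 1 < β) (h₂ : 2 ≤ β ^ m) (hma : 4 ≤ m * a)
    (ha : ∀ n, a ≤ h n) (hstep : ∀ n : ℕ, |h (n + 1) - h n| ≤ a / 2 / (n + 1))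
    (hJ : ∀ t, MapClusterPt t atTop h ↔ t ∈ J) (hbdd : BddAbove (range h)) :
    insertionSet β m (place m h) ⊆ extAccLevelSet β J := by
  intro p hp
  obtain ⟨hx, hy, hreal⟩ := insertionSet_subset_accLevelSet hβ h₂ hma ha hstep hJ hp
  refine ⟨hx, hy, ?_⟩
  rw [← hreal]
  exact (image_preimage_eq_of_subset
    (accPoints_subset_range_coe_of_bddAbove hβ h₂ hma ha hstep hp hbdd)).symm

end PrescribedRate

section Dimension

lemma mul_dimH_range_le {ι X Y : Type*} [MetricSpace X] [MetricSpace Y] {Φ : ι → X} {Ψ : ι → Y}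
    {C r : NNReal} (hr : 0 < r)
    (h : ∀ s t, dist (Ψ s) (Ψ t) ≤ C * dist (Φ s) (Φ t) ^ (r : ℝ)) :
    r * dimH (range Ψ) ≤ dimH (range Φ) := by
  rcases isEmpty_or_nonempty ι with hι | ⟨⟨i⟩⟩
  · rw [range_eq_empty, dimH_empty, mul_zero]
    exact zero_le
  have hfactor : Ψ.FactorsThrough Φ := fun s t hst => by
    have hdist := h s t
    rw [hst, dist_self, Real.zero_rpow (NNReal.coe_ne_zero.2 hr.ne'), mul_zero] at hdist
    exact dist_le_zero.1 hdist
  set g : X → Y := Function.extend Φ Ψ fun _ => Ψ i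
  have hg : ∀ s, g (Φ s) = Ψ s := hfactor.extend_apply _
  have hholder : HolderOnWith C r g (range Φ) := by
    rintro _ ⟨s, rfl⟩ _ ⟨t, rfl⟩
    rw [hg, hg, edist_dist, edist_dist, ENNReal.ofReal_rpow_of_nonneg dist_nonneg r.coe_nonneg,
      ← ENNReal.ofReal_coe_nnreal, ← ENNReal.ofReal_mul C.coe_nonneg]
    exact ENNReal.ofReal_le_ofReal (h s t)
  have himage : g '' range Φ = range Ψ := by rw [← range_comp, show g ∘ Φ = Ψ from funext hg]
  rw [← himage, mul_comm]
  exact ENNReal.mul_le_of_le_div (hholder.dimH_image_le hr)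

lemma dimH_le_two (s : Set (ℝ × ℝ)) : dimH s ≤ 2 := by
  refine (dimH_mono (subset_univ s)).trans_eq ?_
  rw [Real.dimH_univ_eq_finrank, Module.finrank_prod, Module.finrank_self]
  norm_num

lemma two_le_dimH_range_ofDigits {q : ℕ} (hq : 1 < q) :
    2 ≤ dimH (range fun s : (ℕ → Fin q) × (ℕ → Fin q) =>
      (Real.ofDigits s.1, Real.ofDigits s.2)) := by
  have hsub : Icc (0 : ℝ) 1 ×ˢ Icc (0 : ℝ) 1 ⊆ range fun s : (ℕ → Fin q) × (ℕ → Fin q) =>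
      (Real.ofDigits s.1, Real.ofDigits s.2) := by
    rintro ⟨x, y⟩ ⟨hx, hy⟩
    obtain ⟨a, -, ha⟩ := Real.ofDigits_SurjOn hq hx
    obtain ⟨b, -, hb⟩ := Real.ofDigits_SurjOn hq hy
    exact ⟨(a, b), Prod.ext ha hb⟩
  refine le_trans (le_of_eq ?_) (dimH_mono hsub)
  rw [Real.dimH_of_nonempty_interior, Module.finrank_prod, Module.finrank_self]
  · norm_num
  · rw [interior_prod_eq, interior_Icc]
    exact (nonempty_Ioo.2 one_pos).prod (nonempty_Ioo.2 one_pos)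

lemma exists_mul_sub_le_mul {N : ℕ → ℕ} (hN : Tendsto (fun i => (N i : ℝ) / i) atTop (𝓝 1))
    {r r' : ℝ} (hr : 0 ≤ r) (hrr' : r < r') : ∃ C, ∀ i : ℕ, r * i - C ≤ r' * N i := by
  have hr' : 0 < r' := hr.trans_lt hrr'
  obtain ⟨k, hk⟩ := eventually_atTop.1 <| (eventually_gt_atTop 0).and
    (hN.eventually_const_lt ((div_lt_one hr').2 hrr'))
  refine ⟨r * k, fun i => ?_⟩
  rcases le_total k i with hki | hik
  · obtain ⟨hi, hlt⟩ := hk i hki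
    rw [div_lt_div_iff₀ hr' (by exact_mod_cast hi)] at hlt
    have hrk : 0 ≤ r * k := by positivity
    linarith
  · have hri : r * i ≤ r * k := by gcongr
    have hpos : 0 ≤ r' * N i := by positivity
    linarith

lemma tendsto_sub_natCast_div (k : ℕ) :
    Tendsto (fun i : ℕ => ((i - k : ℕ) : ℝ) / i) atTop (𝓝 1) := by
  have hlim := (tendsto_const_div_atTop_nhds_zero_nat (k : ℝ)).const_sub 1
  rw [sub_zero] at hlim
  refine hlim.congr' ?_
  filter_upwards [eventually_ge_atTop k, eventually_gt_atTop 0] with i hki hi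
  rw [Nat.cast_sub hki, sub_div, div_self (by exact_mod_cast hi.ne')]

lemma exists_first_ne {α : Type*} {c d : ℕ → α} (h : c ≠ d) :
    ∃ i, c i ≠ d i ∧ ∀ j < i, c j = d j := by
  classical
  have hex := Function.ne_iff.1 h
  exact ⟨Nat.find hex, Nat.find_spec hex, fun j hj => not_not.1 (Nat.find_min hex hj)⟩

/-- If the first disagreement of `c` and `d` is at `i`, the codes differ by at least
`B ^ (-i - 2)` and the base `q` expansions by at most `q ^ (-N i)`. -/
lemma exists_abs_ofDigits_sub_le {B : ℝ} (hB : 1 < B) {r r' : ℝ} (hr : 0 < r) (hrr' : r < r')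
    {q : ℕ} (hq : B ^ r' ≤ q) {N : ℕ → ℕ} (hN : Tendsto (fun i => (N i : ℝ) / i) atTop (𝓝 1)) :
    ∃ K : NNReal, ∀ {c d : ℕ → ℝ} {a b : ℕ → Fin q}, (∀ i, c i ∈ Icc 0 (1 - 2 / B)) →
      (∀ i, d i ∈ Icc 0 (1 - 2 / B)) → (∀ i, c i ≠ d i → 1 / B ≤ |c i - d i|) →
      (∀ i, (∀ j < i, c j = d j) → ∀ k < N i, a k = b k) →
      |Real.ofDigits a - Real.ofDigits b| ≤ K * |code B c - code B d| ^ r := by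
  have hB0 : 0 < B := one_pos.trans hB
  obtain ⟨C, hC⟩ := exists_mul_sub_le_mul hN hr.le hrr'
  refine ⟨⟨B ^ (2 * r + C), by positivity⟩, fun {c d a b} hc hd hsep hagree => ?_⟩
  rcases eq_or_ne c d with rfl | hne
  · obtain rfl : a = b := funext fun k => by
      obtain ⟨i, hi⟩ := exists_nat_gt ((r' * k + C) / r)
      rw [div_lt_iff₀' hr] at hi
      refine hagree i (fun _ _ => rfl) k ?_
      have hlt : r' * k < r' * N i := by linarith [hC i]
      exact_mod_cast lt_of_mul_lt_mul_left hlt (hr.trans hrr').le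
    rw [sub_self (Real.ofDigits a), abs_zero]
    exact mul_nonneg (NNReal.coe_nonneg _) (Real.rpow_nonneg (abs_nonneg _) r)
  obtain ⟨i, hi, hlt⟩ := exists_first_ne hne
  calc |Real.ofDigits a - Real.ofDigits b|
      ≤ ((q : ℝ) ^ N i)⁻¹ := Real.abs_ofDigits_sub_ofDigits_le (hagree i hlt)
    _ ≤ ((B ^ r') ^ N i)⁻¹ := by gcongr
    _ = B ^ (-(r' * N i)) := by rw [← Real.rpow_mul_natCast hB0.le, ← Real.rpow_neg hB0.le]
    _ ≤ B ^ (-(r * i - C)) := by gcongr; exacts [hB.le, hC i]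
    _ = B ^ (2 * r + C) * (1 / B ^ (i + 2)) ^ r := by
        rw [one_div, ← Real.rpow_natCast, ← Real.rpow_neg hB0.le, ← Real.rpow_mul hB0.le,
          ← Real.rpow_add hB0]
        congr 1
        push_cast
        ring
    _ ≤ B ^ (2 * r + C) * |code B c - code B d| ^ r := by
        gcongr
        exact inv_le_abs_code_sub hB hc hd hlt (hsep i hi)

variable {β : ℝ} {m : ℕ} {P : ℕ → ℕ}

lemma exists_dist_ofDigits_le_dist_insertionPair (hβ : 1 < β) (h₂ : 2 ≤ β ^ m)
    (hpow : ∀ l, 2 ^ l ≤ P l) {r r' : ℝ} (hr : 0 < r) (hrr' : r < r') {q : ℕ}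
    (hq : (β ^ m) ^ r' ≤ q) {e : Fin q → ℝ} (he : e.Injective)
    (hmem : ∀ k, e k ∈ nonzeroLetters β m) :
    ∃ K : NNReal, ∀ s t : (ℕ → Fin q) × (ℕ → Fin q),
      dist (Real.ofDigits s.1, Real.ofDigits s.2) (Real.ofDigits t.1, Real.ofDigits t.2) ≤
        K * dist (insertionPair β m P (e ∘ s.1) (e ∘ s.2))
          (insertionPair β m P (e ∘ t.1) (e ∘ t.2)) ^ r := by
  have hm := ne_zero_of_two_le_pow h₂
  have hB := one_lt_pow₀ hβ hm
  have hY (a : ℕ → Fin q) : ∀ i, IsLetter β m (withMarker (e ∘ a) i) :=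
    forall_withMarker (isLetter_zero hβ h₂) fun i => (hmem _).1
  have hX (s : (ℕ → Fin q) × (ℕ → Fin q)) : ∀ i, IsLetter β m
      (insertPrefixes P (withMarker (e ∘ s.2)) (e ∘ s.1) i) :=
    forall_insertPrefixes (isLetter_zero hβ h₂) (hY s.2) fun i => (hmem _).1
  obtain ⟨K₁, hK₁⟩ := exists_abs_ofDigits_sub_le hB hr hrr' hq (tendsto_freeCount_div hpow)
  obtain ⟨K₂, hK₂⟩ := exists_abs_ofDigits_sub_le hB hr hrr' hq (tendsto_sub_natCast_div 3)
  refine ⟨max K₁ K₂, fun s t => max_le ?_ ?_⟩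
  · refine (hK₁ (fun i => (hX s i).mem_Icc) (fun i => (hX t i).mem_Icc)
      (fun i => (hX s i).1.inv_le_abs_sub (one_pos.trans hβ) (hX t i).1)
      fun i hi k hk => he (eq_of_insertPrefixes_eq hi k hk)).trans ?_
    gcongr
    exacts [le_max_left _ _, le_max_left _ _]
  · refine (hK₂ (fun i => (hY s.2 i).mem_Icc) (fun i => (hY t.2 i).mem_Icc)
      (fun i => (hY s.2 i).1.inv_le_abs_sub (one_pos.trans hβ) (hY t.2 i).1)
      fun i hi k hk => he ?_).trans ?_
    · simpa only [withMarker_add_three, Function.comp_apply] using hi (k + 3) (by omega)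
    · gcongr
      exacts [le_max_right _ _, le_max_right _ _]

lemma mul_two_le_dimH_insertionSet (hβ : 1 < β) (h₂ : 2 ≤ β ^ m)
    (hpow : ∀ l, 2 ^ l ≤ P l) {r : NNReal} {r' : ℝ} (hr : 0 < r) (hrr' : r < r')
    (hcard : (β ^ m) ^ r' ≤ (nonzeroLetters β m).ncard) :
    r * 2 ≤ dimH (insertionSet β m P) := by
  have hm := ne_zero_of_two_le_pow h₂
  have hr₀ : (0 : ℝ) < r := NNReal.coe_pos.2 hr
  have hq : 1 < (nonzeroLetters β m).ncard := by
    exact_mod_cast (Real.one_lt_rpow (one_lt_pow₀ hβ hm) (hr₀.trans hrr')).trans_le hcard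
  have hfin := finite_nonzeroLetters (one_pos.trans hβ) m
  obtain ⟨e⟩ : Nonempty (Fin (nonzeroLetters β m).ncard ≃ nonzeroLetters β m) := by
    have := hfin.to_subtype
    exact ⟨(Finite.equivFinOfCardEq (Nat.card_coe_set_eq _)).symm⟩
  obtain ⟨K, hK⟩ := exists_dist_ofDigits_le_dist_insertionPair hβ h₂ hpow hr₀ hrr' hcard
    (Subtype.val_injective.comp e.injective) fun k => (e k).2
  calc r * 2 ≤ r * dimH (range fun s : (ℕ → Fin (nonzeroLetters β m).ncard) × _ =>
          (Real.ofDigits s.1, Real.ofDigits s.2)) := by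
        gcongr
        exact two_le_dimH_range_ofDigits hq
    _ ≤ _ := mul_dimH_range_le hr hK
    _ ≤ dimH (insertionSet β m P) := dimH_mono <| by
        rintro _ ⟨s, rfl⟩
        exact ⟨_, _, fun i => (e (s.1 i)).2, fun i => (e (s.2 i)).2, rfl⟩

lemma dimH_eq_two_of_eventually_insertionSet_subset (hβ : 1 < β) {P : ℕ → ℕ → ℕ} {S : Set (ℝ × ℝ)}
    (hpow : ∀ᶠ m in atTop, ∀ l, 2 ^ l ≤ P m l)
    (hS : ∀ᶠ m in atTop, insertionSet β m (P m) ⊆ S) : dimH S = 2 := by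
  refine (dimH_le_two S).antisymm ?_
  rw [← one_mul (2 : ENNReal)]
  refine ENNReal.mul_le_of_forall_lt fun r hr b hb => ?_
  lift r to NNReal using (hr.trans ENNReal.one_lt_top).ne
  rcases eq_zero_or_pos r with rfl | hr₀
  · simp
  obtain ⟨r', hrr', hr'⟩ := exists_between (show (r : ℝ) < 1 by exact_mod_cast hr)
  obtain ⟨m, hcard, h₂, hpow, hS⟩ :=
    ((eventually_rpow_le_ncard_nonzeroLetters hβ (r.coe_nonneg.trans hrr'.le) hr').and
      (((tendsto_pow_atTop_atTop_of_one_lt hβ).eventually_ge_atTop 2).and (hpow.and hS))).exists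
  rw [Real.rpow_natCast_mul (one_pos.trans hβ).le] at hcard
  calc r * b ≤ r * 2 := by gcongr
    _ ≤ dimH (insertionSet β m (P m)) :=
      mul_two_le_dimH_insertionSet hβ h₂ hpow hr₀ hrr' hcard
    _ ≤ dimH S := dimH_mono hS

end Dimension

end

end BetaExpansion

theorem mainTheorem3 (β : ℝ) (hβ : 1 < β) (J : Set ℝ) (hne : J.Nonempty)
    (hint : J.OrdConnected) (hclosed : IsClosed J) (hpos : J ⊆ Set.Ioi 0) :
    dimH (BetaExpansion.accLevelSet β J) = 2 ∧
      (BddAbove J → dimH (BetaExpansion.extAccLevelSet β J) = 2) := by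
  open BetaExpansion in
  have hbelow : BddBelow J := ⟨0, fun x hx => (hpos hx).le⟩
  have ha : 0 < sInf J := hpos (hclosed.csInf_mem hne hbelow)
  obtain ⟨h, hmem, hstep, hcluster⟩ :=
    exists_slow_seq_mapClusterPt_iff hne hint hclosed hbelow (half_pos ha)
  have hle (n : ℕ) : sInf J ≤ h n := csInf_le hbelow (hmem n)
  have hlarge : ∀ᶠ m : ℕ in atTop, 2 ≤ β ^ m ∧ 4 ≤ m * sInf J :=
    ((tendsto_pow_atTop_atTop_of_one_lt hβ).eventually_ge_atTop 2).and
      ((tendsto_natCast_atTop_atTop.atTop_mul_const ha).eventually_ge_atTop 4)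
  have hpow : ∀ᶠ m in atTop, ∀ l, 2 ^ l ≤ place m h l :=
    hlarge.mono fun m hm => two_pow_le_place hm.2 hle
  refine ⟨?_, fun hbdd => ?_⟩ <;>
    refine dimH_eq_two_of_eventually_insertionSet_subset hβ hpow (hlarge.mono fun m hm => ?_)
  · exact insertionSet_subset_accLevelSet hβ hm.1 hm.2 hle hstep hcluster
  · exact insertionSet_subset_extAccLevelSet hβ hm.1 hm.2 hle hstep hcluster
      (hbdd.mono (range_subset_iff.2 hmem))
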